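/- **Theorem 4.1.** Let $z,z',w,w'\in\mathbb C$ satisfy $(z+k)(z'+k)>0$ and $(w+k)(w'+k)>0$ for all $k\in\mathbb Z$, and $z+z'+w+w'>-1$ (an inequality $c>r$ with $r$ real includes that the complex number $c$ is real). For $N\ge1$ let $\mathbb{GT}_N$ be the set of signatures $\lambda=(\lambda_1\ge\dots\ge\lambda_N)\in\mathbb Z^N$, put $l_j=\lambda_j+N-j$ (and likewise $n_j=\nu_j+N-j$ for $\nu\in\mathbb{GT}_N$), $V_N(\lambda)=\prod_{1\le i<j\le N}(l_i-l_j)$ and $\operatorname{Dim}_N\lambda=V_N(\lambda)/\prod_{i=1}^{N-1}i!$. The cotransition link $\Lambda^{N+1}_N$ is the matrix with rows indexed by $\mathbb{GT}_{N+1}$ and columns indexed by $\mathbb{GT}_N$, $$\Lambda^{N+1}_N(\lambda,\nu)=N!\,\frac{V_N(\nu)}{V_{N+1}(\lambda)}\ \text{ if }\ \lambda_1\ge\nu_1\ge\lambda_2\ge\dots\ge\nu_N\ge\lambda_{N+1},\qquad \Lambda^{N+1}_N(\lambda,\nu)=0\ \text{ otherwise}.$$ For parameters $(u,u',v,v')$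 let $\mathcal D$ be the $\mathbb Z\times\mathbb Z$ matrix with $\mathcal D(x,x+1)=(x-u)(x-u')$, $\mathcal D(x,x-1)=(x+v)(x+v')$, $\mathcal D(x,x)=-\mathcal D(x,x+1)-\mathcal D(x,x-1)$ and all other entries $0$, and let $$\mathcal D^{(N)}(\lambda,\nu)=\frac{\operatorname{Dim}_N\nu}{\operatorname{Dim}_N\lambda}\sum_{j=1}^N\mathcal D(l_j,n_j)\,\mathbf 1_{\{l_i=n_i\ \forall i\ne j\}}-d_N\mathbf 1_{\lambda=\nu},\qquad d_N=\frac{N(N-1)(N-2)}3-(u+u'+v+v')\frac{N(N-1)}2 ,$$ with the parameters depending on $N$ by $u=u_N=z+N-1$, $u'=u_N'=z'+N-1$, $v=w$, $v'=w'$. For a matrix $Q=-q+\widetilde Q$ of transition rates on a countable set ($-q$ its diagonal part, $\widetilde Q$ its off-diagonal part) put $P^{[0]}(t)=e^{-tq}$, $P^{[n]}(t)=\int_0^te^{-\tau q}\,\widetilde Q\,P^{[n-1]}(t-\tau)\,d\tau$ for $n\ge 1$, and $\overline P(t)=\sum_{n\ge0}P^{[n]}(t)$ (the minimal solution of the Kolmogorov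 equations); $Q$ is called regular if $\overline P(t)$ is stochastic for all $t\ge0$. Let $(P_N(t))_{t\ge0}$ be the family $\overline P(t)$ for $Q=\mathcal D^{(N)}$. Then $\mathcal D^{(N)}$ is regular for every $N\ge1$, so that each $P_N(t)$ is a stochastic matrix, and $$P_{N+1}(t)\,\Lambda^{N+1}_N=\Lambda^{N+1}_N\,P_N(t)\qquad\text{for all } t\ge0,\ N\ge1.$$ -/

import Mathlib

open scoped ENNReal ComplexOrder

noncomputable section

namespace GelfandTsetlin

/-! Markov chains on a countable set, given by a matrix of transition rates. -/

section Chains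

variable {A B C : Type*}

/-- Product of two nonnegative matrices (kernels between countable sets). -/
def comp (K : A → B → ℝ≥0∞) (L : B → C → ℝ≥0∞) : A → C → ℝ≥0∞ :=
  fun a c => ∑' b, K a b * L b c

/-- `jumpTerm Q n t a b` is the matrix element `P^[n](t; a, b)` (the probability to get from `a`
to `b` in time `t` in exactly `n` jumps), defined by `P^[0](t) = exp (-t q)` and
`P^[n+1](t) = ∫_0^t exp (-τ q) Q' P^[n](t - τ) dτ`, where `-q` is the diagonal part of the matrix
`Q` of transition rates and `Q'` its off-diagonal part. The off-diagonal entries of a matrix of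
transition rates are nonnegative, so all the terms are nonnegative and are taken in `[0, ∞]`. -/
def jumpTerm [DecidableEq A] (Q : A → A → ℝ) : ℕ → ℝ → A → A → ℝ≥0∞
  | 0, t, a, b => if a = b then ENNReal.ofReal (Real.exp (t * Q a a)) else 0
  | n + 1, t, a, b => ∫⁻ τ in Set.Icc (0 : ℝ) t, ∑' c : A,
      if c = a then 0 else
        ENNReal.ofReal (Real.exp (τ * Q a a)) * ENNReal.ofReal (Q a c) *
          jumpTerm Q n (t - τ) c b

/-- The minimal solution of the Kolmogorov equations with the matrix `Q` of transition rates: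
the sum of the `P^[n](t)` over all `n`. -/
def minimalSolution [DecidableEq A] (Q : A → A → ℝ) (t : ℝ) (a b : A) : ℝ≥0∞ :=
  ∑' n : ℕ, jumpTerm Q n t a b

/-- `Q` is regular: its minimal solution is stochastic. It is then the unique Markov semigroup
with the matrix `Q` of transition rates. -/
def IsRegular [DecidableEq A] (Q : A → A → ℝ) : Prop :=
  ∀ t : ℝ, 0 ≤ t → ∀ a : A, ∑' b : A, minimalSolution Q t a b = 1

end Chains

/-- Signatures of length `N`: weakly decreasing `N`-tuples of integers. -/
abbrev Signature (N : ℕ) : Type := {la : Fin N → ℤ // Antitone la}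

/-- The shifted coordinates `l_j = λ_j + N - j` (here `j` runs from `0` to `N - 1`). -/
def coord {N : ℕ} (la : Signature N) (j : Fin N) : ℤ :=
  la.1 j + N - 1 - ((j : ℕ) : ℤ)

/-- The product of `l_i - l_j = λ_i - i - λ_j + j` over `i < j`. -/
def vandermonde {N : ℕ} (la : Signature N) : ℝ :=
  ∏ i : Fin N, ∏ j ∈ Finset.Ioi i, ((coord la i - coord la j : ℤ) : ℝ)

/-- The dimension of the irreducible representation of `U(N)` with highest weight `la`. -/
def dim {N : ℕ} (la : Signature N) : ℝ :=
  vandermonde la / ∏ i ∈ Finset.range N, (Nat.factorial i : ℝ)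

/-- Interlacing: `λ_1 ≥ ν_1 ≥ λ_2 ≥ ν_2 ≥ ... ≥ ν_N ≥ λ_{N+1}`. -/
abbrev Interlaces {N : ℕ} (nu : Signature N) (la : Signature (N + 1)) : Prop :=
  ∀ i : Fin N, nu.1 i ≤ la.1 i.castSucc ∧ la.1 i.succ ≤ nu.1 i

/-- The cotransition probabilities of the Gelfand–Tsetlin graph. -/
def linkProb (N : ℕ) (la : Signature (N + 1)) (nu : Signature N) : ℝ :=
  if Interlaces nu la then (Nat.factorial N : ℝ) * (vandermonde nu / vandermonde la) else 0

/-- The link from level `N + 1` to level `N`, as a (nonnegative) kernel. -/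
def link (N : ℕ) (la : Signature (N + 1)) (nu : Signature N) : ℝ≥0∞ :=
  ENNReal.ofReal (linkProb N la nu)

/-- Transition rates of the bilateral birth and death process on `ℤ`. For admissible parameters
`(x - u) (x - u')` and `(x + v) (x + v')` are positive real numbers. -/
def bdRate (u u' v v' : ℂ) (x y : ℤ) : ℝ :=
  if y = x + 1 then ((x - u) * (x - u')).re
  else if y = x - 1 then ((x + v) * (x + v')).re
  else if y = x then -((x - u) * (x - u')).re - ((x + v) * (x + v')).re
  else 0

/-- The constant `d_N`; for admissible parameters `u + u' + v + v'` is real. -/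
def dConst (N : ℕ) (u u' v v' : ℂ) : ℝ :=
  (N : ℝ) * (N - 1) * (N - 2) / 3 - (u + u' + v + v').re * ((N : ℝ) * (N - 1) / 2)

/-- Transition rates on signatures of length `N`. -/
def gtRate (N : ℕ) (u u' v v' : ℂ) (la nu : Signature N) : ℝ :=
  dim nu / dim la *
      (∑ j : Fin N, if ∀ i : Fin N, i ≠ j → coord la i = coord nu i
        then bdRate u u' v v' (coord la j) (coord nu j) else 0)
    - (if la = nu then dConst N u u' v v' else 0)

/-- Transition rates on level `N` with `u = z + N - 1`, `u' = z' + N - 1`, `v = w`, `v' = w'`. -/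
def zwRate (z z' w w' : ℂ) (N : ℕ) : Signature N → Signature N → ℝ :=
  gtRate N (z + N - 1) (z' + N - 1) w w'

/-- The semigroup on level `N`. -/
def zwSemigroup (z z' w w' : ℂ) (N : ℕ) (t : ℝ) : Signature N → Signature N → ℝ≥0∞ :=
  minimalSolution (zwRate z z' w w' N) t

end GelfandTsetlin

end

namespace GelfandTsetlin

open MeasureTheory Set Filter Topology

/-! ### Minimal solutions: backward equation, maximum principle, regularity, intertwining. -/

section Chains

variable {A : Type*} [DecidableEq A]

/-! The rates at level N are a Doob transform: the sum of one birth-death operator D per coordinate,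
conjugated by the Vandermonde determinant V and shifted by d_N. So if V f is an alternant det
g_c(l_i), the rates act on f by applying D to one column function g_c at a time (`sum_gtRate_mul`);
the walls of the chamber do not matter because alternants vanish there.

Three choices of columns carry the proof. For monomials, D does not raise the degree, so by
triangularity V is an eigenfunction with eigenvalue d_N and the rows sum to zero (`sum_gtRate`).
Replacing y^(N-1) by y^(N+1) gives the complete symmetric function h_2, whose image is a combination
of h_2, h_1 and 1; hence 1 + 2 h_2 is a Lyapunov function with finite sublevel sets
(`exists_sum_gtRate_mul_lyapunov_le`). Finally, interlacing is a determinant of step functions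
(`alternant_interlacingColumns`). The one-particle relation `bdGen_indicator` moves D from the upper
level to its transpose on the lower one, up to a constant that d_(N+1) - d_N absorbs, so the links
intertwine the rates (`sum_gtRate_mul_linkProb`).

For the semigroups, the minimal solution applied to a bounded function solves the backward equation
(`hasDerivAt_realAct`), and the Lyapunov function yields a maximum principle (`nonpos_of_backward`),
hence uniqueness of bounded solutions. The constant 1 is a solution, which gives regularity; the
columns of both sides of the intertwining relation are bounded solutions with the same initial
value. -/

theorem measurable_jumpTerm [Countable A] (Q : A → A → ℝ) (n : ℕ) (a b : A) :
    Measurable fun t => jumpTerm Q n t a b := by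
  induction n generalizing a with
  | zero =>
    simp only [jumpTerm]
    split_ifs
    · fun_prop
    · exact measurable_const
  | succ n ih =>
    simp only [jumpTerm]
    set F : ℝ → ℝ → ℝ≥0∞ := fun t τ => ∑' c : A,
      if c = a then 0 else
        ENNReal.ofReal (Real.exp (τ * Q a a)) * ENNReal.ofReal (Q a c) *
          jumpTerm Q n (t - τ) c b with hF
    have hm : Measurable (Function.uncurry F) := by
      refine Measurable.tsum fun c => ?_
      by_cases hc : c = a
      · simp [hc]
      · simp only [hc, if_false]
        have h1 := (ih c).comp (measurable_fst.sub measurable_snd : Measurable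
          fun p : ℝ × ℝ => p.1 - p.2)
        refine Measurable.mul ?_ h1
        fun_prop
    -- The domain of integration depends on t, so it is encoded as the indicator of a region in the
    -- (t, τ) plane before Tonelli applies.
    have hs : MeasurableSet {p : ℝ × ℝ | p.2 ∈ Icc 0 p.1} :=
      (measurableSet_le measurable_const measurable_snd).inter
        (measurableSet_le measurable_snd measurable_fst)
    have h2 := (hm.indicator hs).lintegral_prod_right' (ν := volume)
    have h3 : ∀ t, ∫⁻ τ in Icc 0 t, F t τ = ∫⁻ τ, {p : ℝ × ℝ | p.2 ∈ Icc 0 p.1}.indicator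
        (Function.uncurry F) (t, τ) := by
      intro t
      rw [← lintegral_indicator measurableSet_Icc]
      rfl
    simpa only [← h3] using h2

/-- The action of `P^[n](t)` on a nonnegative function. -/
noncomputable def jumpAct (Q : A → A → ℝ) (φ : A → ℝ≥0∞) (n : ℕ) (t : ℝ) (a : A) : ℝ≥0∞ :=
  ∑' b, jumpTerm Q n t a b * φ b

/-- The action of the minimal solution on a nonnegative function. -/
noncomputable def semigroupAct (Q : A → A → ℝ) (φ : A → ℝ≥0∞) (t : ℝ) (a : A) : ℝ≥0∞ :=
  ∑' b, minimalSolution Q t a b * φ b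

theorem semigroupAct_eq_tsum (Q : A → A → ℝ) (φ : A → ℝ≥0∞) (t : ℝ) (a : A) :
    semigroupAct Q φ t a = ∑' n, jumpAct Q φ n t a := by
  simp only [semigroupAct, minimalSolution, jumpAct, ← ENNReal.tsum_mul_right]
  exact ENNReal.tsum_comm

theorem measurable_jumpAct [Countable A] (Q : A → A → ℝ) (φ : A → ℝ≥0∞) (n : ℕ) (a : A) :
    Measurable fun t => jumpAct Q φ n t a :=
  Measurable.tsum fun b => (measurable_jumpTerm Q n a b).mul_const _

theorem measurable_semigroupAct [Countable A] (Q : A → A → ℝ) (φ : A → ℝ≥0∞) (a : A) :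
    Measurable fun t => semigroupAct Q φ t a := by
  simp only [semigroupAct_eq_tsum]
  exact Measurable.tsum fun n => measurable_jumpAct Q φ n a

theorem jumpAct_zero (Q : A → A → ℝ) (φ : A → ℝ≥0∞) (t : ℝ) (a : A) :
    jumpAct Q φ 0 t a = ENNReal.ofReal (Real.exp (t * Q a a)) * φ a := by
  simp only [jumpAct, jumpTerm]
  rw [tsum_eq_single a]
  · simp
  · intro b hb
    simp [hb.symm]

variable {Q : A → A → ℝ} {S : A → Finset A} {φ : A → ℝ≥0∞}

theorem jumpAct_succ [Countable A] (hS : ∀ a c, c ∉ S a → Q a c = 0) (n : ℕ) (t : ℝ) (a : A) :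
    jumpAct Q φ (n + 1) t a = ∫⁻ τ in Icc (0 : ℝ) t, ENNReal.ofReal (Real.exp (τ * Q a a)) *
      ∑ c ∈ (S a).erase a, ENNReal.ofReal (Q a c) * jumpAct Q φ n (t - τ) c := by
  have hmeas : ∀ c b, Measurable fun τ => jumpTerm Q n (t - τ) c b := fun c b =>
    (measurable_jumpTerm Q n c b).comp (measurable_const.sub measurable_id)
  simp only [jumpAct, jumpTerm]
  have h1 : ∀ b, (∫⁻ τ in Icc (0 : ℝ) t, ∑' c : A,
      if c = a then 0 else
        ENNReal.ofReal (Real.exp (τ * Q a a)) * ENNReal.ofReal (Q a c) *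
          jumpTerm Q n (t - τ) c b) * φ b = ∫⁻ τ in Icc (0 : ℝ) t,
      ENNReal.ofReal (Real.exp (τ * Q a a)) * ∑ c ∈ (S a).erase a, ENNReal.ofReal (Q a c) *
          (jumpTerm Q n (t - τ) c b * φ b) := by
    intro b
    have h2 : ∀ τ, (∑' c : A, if c = a then 0 else
        ENNReal.ofReal (Real.exp (τ * Q a a)) * ENNReal.ofReal (Q a c) *
          jumpTerm Q n (t - τ) c b) = ∑ c ∈ (S a).erase a,
        ENNReal.ofReal (Real.exp (τ * Q a a)) * ENNReal.ofReal (Q a c) *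
          jumpTerm Q n (t - τ) c b := by
      intro τ
      rw [tsum_eq_sum (s := (S a).erase a)]
      · refine Finset.sum_congr rfl fun c hc => ?_
        rw [if_neg (Finset.ne_of_mem_erase hc)]
      · intro c hc
        by_cases hca : c = a
        · simp [hca]
        · have : c ∉ S a := fun h => hc (Finset.mem_erase.2 ⟨hca, h⟩)
          simp [hS a c this]
    simp only [h2]
    rw [← lintegral_mul_const]
    · refine lintegral_congr fun τ => ?_
      rw [Finset.sum_mul, Finset.mul_sum]
      refine Finset.sum_congr rfl fun c _ => ?_
      ring
    · exact Finset.measurable_sum _ fun c _ => Measurable.mul (by fun_prop) (hmeas c b)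
  simp only [h1]
  rw [← lintegral_tsum]
  · refine lintegral_congr fun τ => ?_
    rw [ENNReal.tsum_mul_left, Summable.tsum_finsetSum (fun _ _ => ENNReal.summable)]
    simp only [ENNReal.tsum_mul_left]
  · intro b
    refine Measurable.aemeasurable (Measurable.mul (by fun_prop) ?_)
    exact Finset.measurable_sum _ fun c _ => ((hmeas c b).mul_const _).const_mul _

/-- The integrated backward Kolmogorov equation. -/
theorem semigroupAct_eq [Countable A] (hS : ∀ a c, c ∉ S a → Q a c = 0) (t : ℝ) (a : A) :
    semigroupAct Q φ t a = ENNReal.ofReal (Real.exp (t * Q a a)) * φ a +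
      ∫⁻ τ in Icc (0 : ℝ) t, ENNReal.ofReal (Real.exp (τ * Q a a)) *
        ∑ c ∈ (S a).erase a, ENNReal.ofReal (Q a c) * semigroupAct Q φ (t - τ) c := by
  have hmeas : ∀ n c, Measurable fun τ => jumpAct Q φ n (t - τ) c := fun n c =>
    (measurable_jumpAct Q φ n c).comp (measurable_const.sub measurable_id)
  rw [semigroupAct_eq_tsum, tsum_eq_zero_add' ENNReal.summable, jumpAct_zero]
  congr 1
  simp only [jumpAct_succ hS]
  rw [← lintegral_tsum]
  · refine lintegral_congr fun τ => ?_
    rw [ENNReal.tsum_mul_left, Summable.tsum_finsetSum (fun _ _ => ENNReal.summable)]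
    simp only [ENNReal.tsum_mul_left, semigroupAct_eq_tsum]
  · intro n
    refine Measurable.aemeasurable (Measurable.mul (by fun_prop) ?_)
    exact Finset.measurable_sum _ fun c _ => (hmeas n c).const_mul _

theorem integral_exp_mul_eq (q t : ℝ) :
    ∫ τ in (0 : ℝ)..t, Real.exp (τ * q) * (-q) = 1 - Real.exp (t * q) := by
  have h : ∀ x ∈ uIcc 0 t, HasDerivAt (fun τ => -Real.exp (τ * q)) (Real.exp (x * q) * (-q)) x := by
    intro x _
    have := ((hasDerivAt_id x).mul_const q).exp.fun_neg
    simpa using this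
  rw [intervalIntegral.integral_eq_sub_of_hasDerivAt h]
  · simp; ring
  · exact Continuous.intervalIntegrable (by fun_prop) _ _

theorem diag_nonpos (hS : ∀ a c, c ∉ S a → Q a c = 0) (hoff : ∀ a c, c ≠ a → 0 ≤ Q a c)
    (hrow : ∀ a, ∑ c ∈ S a, Q a c = 0) (a : A) :
    ∑ c ∈ (S a).erase a, Q a c = -Q a a ∧ Q a a ≤ 0 := by
  have h1 : ∑ c ∈ (S a).erase a, Q a c = -Q a a := by
    by_cases ha : a ∈ S a
    · have := Finset.add_sum_erase (S a) (Q a) ha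
      rw [hrow] at this
      linarith
    · rw [Finset.erase_eq_of_notMem ha, hrow, hS a a ha, neg_zero]
  have h2 : 0 ≤ ∑ c ∈ (S a).erase a, Q a c :=
    Finset.sum_nonneg fun c hc => hoff a c (Finset.ne_of_mem_erase hc)
  exact ⟨h1, by linarith⟩

/-- Induction on the number of jumps: if at most n jumps give at most M, conditioning on the first
jump gives at most e^(tq) M + (1 - e^(tq)) M = M, where q = `Q a a`. -/
theorem semigroupAct_le [Countable A] (hS : ∀ a c, c ∉ S a → Q a c = 0)
    (hoff : ∀ a c, c ≠ a → 0 ≤ Q a c) (hrow : ∀ a, ∑ c ∈ S a, Q a c = 0)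
    {M : ℝ≥0∞} (hφ : ∀ a, φ a ≤ M) {t : ℝ} (ht : 0 ≤ t) (a : A) :
    semigroupAct Q φ t a ≤ M := by
  rw [semigroupAct_eq_tsum]
  refine ENNReal.tsum_le_of_sum_range_le fun n => ?_
  induction n generalizing t a with
  | zero => simp
  | succ n ih =>
    obtain ⟨hq, hq0⟩ := diag_nonpos hS hoff hrow a
    have hmeas : ∀ n c, Measurable fun τ => jumpAct Q φ n (t - τ) c := fun n c =>
      (measurable_jumpAct Q φ n c).comp (measurable_const.sub measurable_id)
    rw [Finset.sum_range_succ', jumpAct_zero]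
    simp only [jumpAct_succ hS]
    rw [← lintegral_finsetSum]
    swap
    · intro n _
      refine Measurable.mul (by fun_prop) ?_
      exact Finset.measurable_sum _ fun c _ => (hmeas n c).const_mul _
    have h1 : ∫⁻ τ in Icc (0 : ℝ) t, ∑ k ∈ Finset.range n, ENNReal.ofReal (Real.exp (τ * Q a a)) *
        ∑ c ∈ (S a).erase a, ENNReal.ofReal (Q a c) * jumpAct Q φ k (t - τ) c ≤
        ∫⁻ τ in Icc (0 : ℝ) t, ENNReal.ofReal (Real.exp (τ * Q a a) * (-Q a a)) * M := by
      refine setLIntegral_mono' measurableSet_Icc fun τ hτ => ?_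
      rw [← Finset.mul_sum, Finset.sum_comm, ENNReal.ofReal_mul (Real.exp_pos _).le, mul_assoc]
      gcongr
      rw [← hq, ENNReal.ofReal_sum_of_nonneg fun c hc => hoff a c (Finset.ne_of_mem_erase hc),
        Finset.sum_mul]
      refine Finset.sum_le_sum fun c _ => ?_
      rw [← Finset.mul_sum]
      gcongr
      exact ih (sub_nonneg.2 hτ.2) c
    have h2 : ∫⁻ τ in Icc (0 : ℝ) t, ENNReal.ofReal (Real.exp (τ * Q a a) * (-Q a a)) * M =
        ENNReal.ofReal (1 - Real.exp (t * Q a a)) * M := by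
      rw [lintegral_mul_const _ (by fun_prop), ← integral_exp_mul_eq,
        intervalIntegral.integral_of_le ht, ← integral_Icc_eq_integral_Ioc,
        ofReal_integral_eq_lintegral_ofReal]
      · exact Continuous.integrableOn_Icc (by fun_prop)
      · exact Eventually.of_forall fun x => mul_nonneg (Real.exp_pos _).le (neg_nonneg.2 hq0)
    have h3 : Real.exp (t * Q a a) ≤ 1 :=
      Real.exp_le_one_iff.2 (mul_nonpos_of_nonneg_of_nonpos ht hq0)
    calc _ ≤ ENNReal.ofReal (1 - Real.exp (t * Q a a)) * M +
          ENNReal.ofReal (Real.exp (t * Q a a)) * M := by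
            gcongr
            · exact h1.trans h2.le
            · exact hφ a
      _ = M := by
        rw [← add_mul, ← ENNReal.ofReal_add (by linarith) (Real.exp_pos _).le]
        simp

/-- The action of the minimal solution on a bounded function, as a real function of time that is
constant for negative times. -/
noncomputable def realAct (Q : A → A → ℝ) (φ : A → ℝ≥0∞) (t : ℝ) (a : A) : ℝ :=
  (semigroupAct Q φ (max t 0) a).toReal

theorem realAct_nonneg (t : ℝ) (a : A) : 0 ≤ realAct Q φ t a := ENNReal.toReal_nonneg

theorem realAct_le [Countable A] (hS : ∀ a c, c ∉ S a → Q a c = 0)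
    (hoff : ∀ a c, c ≠ a → 0 ≤ Q a c) (hrow : ∀ a, ∑ c ∈ S a, Q a c = 0)
    {M : ℝ} (hM : 0 ≤ M) (hφ : ∀ a, φ a ≤ ENNReal.ofReal M) (t : ℝ) (a : A) :
    realAct Q φ t a ≤ M :=
  ENNReal.toReal_le_of_le_ofReal hM (semigroupAct_le hS hoff hrow hφ (le_max_right _ _) a)

theorem ofReal_realAct [Countable A] (hS : ∀ a c, c ∉ S a → Q a c = 0)
    (hoff : ∀ a c, c ≠ a → 0 ≤ Q a c) (hrow : ∀ a, ∑ c ∈ S a, Q a c = 0)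
    {M : ℝ} (hφ : ∀ a, φ a ≤ ENNReal.ofReal M) {t : ℝ} (ht : 0 ≤ t) (a : A) :
    ENNReal.ofReal (realAct Q φ t a) = semigroupAct Q φ t a := by
  rw [realAct, max_eq_left ht, ENNReal.ofReal_toReal]
  exact ((semigroupAct_le hS hoff hrow hφ ht a).trans_lt ENNReal.ofReal_lt_top).ne

/-- Substituting s = t - τ leaves t only in a prefactor and in the upper limit, so regularity in t
bootstraps: a bounded measurable integrand gives continuity, a continuous one differentiability. -/
theorem realAct_eq [Countable A] (hS : ∀ a c, c ∉ S a → Q a c = 0)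
    (hoff : ∀ a c, c ≠ a → 0 ≤ Q a c) (hrow : ∀ a, ∑ c ∈ S a, Q a c = 0)
    {M : ℝ} (hφ : ∀ a, φ a ≤ ENNReal.ofReal M) {t : ℝ} (ht : 0 ≤ t) (a : A) :
    realAct Q φ t a = Real.exp (t * Q a a) * ((φ a).toReal +
      ∫ s in (0 : ℝ)..t, Real.exp (-(s * Q a a)) *
        ∑ c ∈ (S a).erase a, Q a c * realAct Q φ s c) := by
  have hoff' : ∀ c ∈ (S a).erase a, 0 ≤ Q a c := fun c hc => hoff a c (Finset.ne_of_mem_erase hc)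
  have hmeas : ∀ c, Measurable fun s => realAct Q φ s c := fun c =>
    ((measurable_semigroupAct Q φ c).comp (measurable_id.max measurable_const)).ennreal_toReal
  have hk0 : ∀ τ, 0 ≤ Real.exp (τ * Q a a) *
        ∑ c ∈ (S a).erase a, Q a c * realAct Q φ (t - τ) c := fun τ =>
    mul_nonneg (Real.exp_pos _).le
      (Finset.sum_nonneg fun c hc => mul_nonneg (hoff' c hc) (realAct_nonneg _ _))
  have h1 : ENNReal.ofReal (realAct Q φ t a) = ENNReal.ofReal (Real.exp (t * Q a a)) * φ a +
      ∫⁻ τ in Icc (0 : ℝ) t, ENNReal.ofReal (Real.exp (τ * Q a a) *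
        ∑ c ∈ (S a).erase a, Q a c * realAct Q φ (t - τ) c) := by
    rw [ofReal_realAct hS hoff hrow hφ ht, semigroupAct_eq hS]
    congr 1
    refine setLIntegral_congr_fun measurableSet_Icc fun τ hτ => ?_
    rw [ENNReal.ofReal_mul (Real.exp_pos _).le, ENNReal.ofReal_sum_of_nonneg
      fun c hc => mul_nonneg (hoff' c hc) (realAct_nonneg _ _)]
    congr 1
    refine Finset.sum_congr rfl fun c hc => ?_
    rw [ENNReal.ofReal_mul (hoff' c hc), ofReal_realAct hS hoff hrow hφ (sub_nonneg.2 hτ.2)]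
  have h2 := congrArg ENNReal.toReal h1
  have hfin : ∫⁻ τ in Icc (0 : ℝ) t, ENNReal.ofReal (Real.exp (τ * Q a a) *
        ∑ c ∈ (S a).erase a, Q a c * realAct Q φ (t - τ) c) ≠ ∞ := by
    intro h
    rw [h, add_top] at h1
    exact ENNReal.ofReal_ne_top h1
  rw [ENNReal.toReal_ofReal (realAct_nonneg _ _), ENNReal.toReal_add
    (ENNReal.mul_ne_top ENNReal.ofReal_ne_top ((hφ a).trans_lt ENNReal.ofReal_lt_top).ne) hfin,
    ENNReal.toReal_mul, ENNReal.toReal_ofReal (Real.exp_pos _).le,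
    ← integral_eq_lintegral_of_nonneg_ae (Eventually.of_forall hk0)] at h2
  · rw [h2, mul_add, integral_Icc_eq_integral_Ioc, ← intervalIntegral.integral_of_le ht]
    congr 1
    have h3 := intervalIntegral.integral_comp_sub_left (a := 0) (b := t) (fun s =>
      Real.exp ((t - s) * Q a a) * ∑ c ∈ (S a).erase a, Q a c * realAct Q φ s c) t
    simp only [sub_sub_cancel, sub_self, sub_zero] at h3
    rw [h3, ← intervalIntegral.integral_const_mul]
    refine intervalIntegral.integral_congr fun s _ => ?_
    rw [← mul_assoc, ← Real.exp_add]
    ring_nf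
  · refine Measurable.aestronglyMeasurable (Measurable.mul (by fun_prop) ?_)
    exact Finset.measurable_sum _ fun c _ =>
      ((hmeas c).comp (measurable_const.sub measurable_id)).const_mul _

theorem realAct_zero [Countable A] (a : A) (hS : ∀ a c, c ∉ S a → Q a c = 0)
    (hoff : ∀ a c, c ≠ a → 0 ≤ Q a c) (hrow : ∀ a, ∑ c ∈ S a, Q a c = 0)
    {M : ℝ} (hφ : ∀ a, φ a ≤ ENNReal.ofReal M) :
    realAct Q φ 0 a = (φ a).toReal := by
  rw [realAct_eq hS hoff hrow hφ le_rfl]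
  simp

theorem continuous_realAct [Countable A] (hS : ∀ a c, c ∉ S a → Q a c = 0)
    (hoff : ∀ a c, c ≠ a → 0 ≤ Q a c) (hrow : ∀ a, ∑ c ∈ S a, Q a c = 0)
    {M : ℝ} (hM : 0 ≤ M) (hφ : ∀ a, φ a ≤ ENNReal.ofReal M) (a : A) :
    Continuous fun t => realAct Q φ t a := by
  have hmeas : ∀ c, Measurable fun s => realAct Q φ s c := fun c =>
    ((measurable_semigroupAct Q φ c).comp (measurable_id.max measurable_const)).ennreal_toReal
  have h1 : ∀ t, realAct Q φ t a = realAct Q φ (max t 0) a := fun t => by simp [realAct]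
  have hint : ∀ x y, IntervalIntegrable (fun s => Real.exp (-(s * Q a a)) *
        ∑ c ∈ (S a).erase a, Q a c * realAct Q φ s c) volume x y := by
    intro x y
    refine IntervalIntegrable.continuousOn_mul ?_ (Continuous.continuousOn (by fun_prop))
    simp only [← Finset.sum_fn]
    refine IntervalIntegrable.sum (f := fun c s => Q a c * realAct Q φ s c) _ fun c _ => ?_
    refine IntervalIntegrable.const_mul ?_ _
    refine (intervalIntegrable_const (c := M)).mono_fun' (hmeas c).aestronglyMeasurable ?_
    refine Eventually.of_forall fun s => ?_
    simp only [Real.norm_eq_abs, abs_of_nonneg (realAct_nonneg (Q := Q) (φ := φ) s c)]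
    exact realAct_le hS hoff hrow hM hφ s c
  have h2 := intervalIntegral.continuous_primitive hint 0
  have h3 : Continuous fun t => Real.exp (t * Q a a) * ((φ a).toReal +
      ∫ s in (0 : ℝ)..t, Real.exp (-(s * Q a a)) *
        ∑ c ∈ (S a).erase a, Q a c * realAct Q φ s c) :=
    Continuous.mul (by fun_prop) ((continuous_const (y := (φ a).toReal)).add h2)
  refine (h3.comp (continuous_id.max (continuous_const (y := (0 : ℝ))))).congr fun t => ?_
  rw [h1, realAct_eq hS hoff hrow hφ (le_max_right _ _)]
  rfl

/-- The backward Kolmogorov equation. -/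
theorem hasDerivAt_realAct [Countable A] (hS : ∀ a c, c ∉ S a → Q a c = 0)
    (hoff : ∀ a c, c ≠ a → 0 ≤ Q a c) (hrow : ∀ a, ∑ c ∈ S a, Q a c = 0)
    {M : ℝ} (hM : 0 ≤ M) (hφ : ∀ a, φ a ≤ ENNReal.ofReal M) (a : A) {t : ℝ} (ht : 0 < t) :
    HasDerivAt (fun t => realAct Q φ t a) (∑ c ∈ S a, Q a c * realAct Q φ t c) t := by
  have hcont := continuous_realAct hS hoff hrow hM hφ
  have hk : Continuous fun s => Real.exp (-(s * Q a a)) *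
        ∑ c ∈ (S a).erase a, Q a c * realAct Q φ s c :=
    Continuous.mul (by fun_prop) (continuous_finsetSum _ fun c _ => (hcont c).const_mul _)
  have h1 := (intervalIntegral.integral_hasDerivAt_right (hk.intervalIntegrable 0 t)
    (hk.stronglyMeasurableAtFilter _ _) hk.continuousAt).const_add (φ a).toReal
  have h2 : HasDerivAt (fun t => Real.exp (t * Q a a)) (Real.exp (t * Q a a) * Q a a) t := by
    simpa using ((hasDerivAt_id t).mul_const (Q a a)).exp
  have h3 := h2.mul h1
  have h4 : (fun t => realAct Q φ t a) =ᶠ[𝓝 t] fun t => Real.exp (t * Q a a) * ((φ a).toReal +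
      ∫ s in (0 : ℝ)..t, Real.exp (-(s * Q a a)) *
        ∑ c ∈ (S a).erase a, Q a c * realAct Q φ s c) := by
    filter_upwards [lt_mem_nhds ht] with s hs
    exact realAct_eq hS hoff hrow hφ hs.le a
  refine (h3.congr_of_eventuallyEq h4).congr_deriv ?_
  have h5 : ∑ c ∈ S a, Q a c * realAct Q φ t c =
      Q a a * realAct Q φ t a + ∑ c ∈ (S a).erase a, Q a c * realAct Q φ t c := by
    by_cases ha : a ∈ S a
    · exact (Finset.add_sum_erase (S a) (fun c => Q a c * realAct Q φ t c) ha).symm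
    · rw [Finset.erase_eq_of_notMem ha, hS a a ha, zero_mul, zero_add]
  rw [h5, realAct_eq hS hoff hrow hφ ht.le a, ← mul_assoc (Real.exp _), ← Real.exp_add]
  simp only [add_neg_cancel, Real.exp_zero, one_mul]
  ring

/-- The maximum principle for the backward equation, for a matrix of rates that has a Lyapunov
function with finite sublevel sets. -/
theorem nonpos_of_backward (hoff : ∀ a c, c ≠ a → 0 ≤ Q a c) (hrow : ∀ a, ∑ c ∈ S a, Q a c = 0)
    {f : A → ℝ} (hf : ∀ a, 0 < f a) (hfin : ∀ r : ℝ, {a | f a ≤ r}.Finite) {C : ℝ}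
    (hlyap : ∀ a, ∑ c ∈ S a, Q a c * f c ≤ C * f a)
    {u : ℝ → A → ℝ} (hcont : ∀ a, Continuous fun t => u t a) {M : ℝ} (hM : ∀ t a, u t a ≤ M)
    (h0 : ∀ a, u 0 a ≤ 0)
    (hderiv : ∀ a t, 0 < t → HasDerivAt (fun t => u t a) (∑ c ∈ S a, Q a c * u t c) t)
    {t : ℝ} (ht : 0 ≤ t) (a : A) : u t a ≤ 0 := by
  by_contra! hpos
  -- The strict excess over C makes ε e^(C's) f a strict supersolution of the backward equation.
  set C' : ℝ := |C| + 1 with hC'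
  have hC'0 : 0 ≤ C' := by positivity
  obtain ⟨ε, hε, hεu⟩ : ∃ ε : ℝ, 0 < ε ∧ ε * (Real.exp (C' * t) * f a) < u t a := by
    have hd : 0 < Real.exp (C' * t) * f a := mul_pos (Real.exp_pos _) (hf a)
    refine ⟨u t a / (Real.exp (C' * t) * f a) / 2, by positivity, ?_⟩
    rw [div_right_comm, div_mul_cancel₀ _ hd.ne']
    linarith
  set w : ℝ → A → ℝ := fun s b => u s b - ε * (Real.exp (C' * s) * f b) with hw
  have hwpos : 0 < w t a := sub_pos.2 hεu
  have hwcont : ∀ b, Continuous fun s => w s b := fun b =>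
    (hcont b).sub (by fun_prop)
  -- Off a finite sublevel set of f the bound M on u is beaten by ε f, so a positive supremum of w
  -- over [0, t] and all states is attained.
  have hout : ∀ s, 0 ≤ s → ∀ b, ¬ f b ≤ M / ε → w s b < 0 := by
    intro s hs b hb
    rw [not_le, div_lt_iff₀ hε] at hb
    have h1 : 1 ≤ Real.exp (C' * s) := Real.one_le_exp (mul_nonneg hC'0 hs)
    have h2 : f b ≤ Real.exp (C' * s) * f b := le_mul_of_one_le_left (hf b).le h1
    have h3 := hM s b
    have h4 := mul_le_mul_of_nonneg_left h2 hε.le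
    simp only [hw]
    linarith
  have haK : f a ≤ M / ε := by
    by_contra h
    exact (hout t ht a h).not_gt hwpos
  choose m hm hmax using fun b => isCompact_Icc.exists_isMaxOn (nonempty_Icc.2 ht)
    (hwcont b).continuousOn
  obtain ⟨a₀, ha₀, hmax₀⟩ := (hfin (M / ε)).toFinset.exists_max_image (fun b => w (m b) b)
    ⟨a, by simpa using haK⟩
  set t₀ := m a₀ with ht₀
  have ht₀Icc : t₀ ∈ Icc 0 t := hm a₀
  have hmaxK : ∀ b, f b ≤ M / ε → ∀ s ∈ Icc 0 t, w s b ≤ w t₀ a₀ := fun b hb s hs =>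
    (hmax b hs).trans (hmax₀ b (by simpa using hb))
  have hw₀ : 0 < w t₀ a₀ := hwpos.trans_le (hmaxK a haK t ⟨ht, le_rfl⟩)
  have hmaxall : ∀ b, ∀ s ∈ Icc 0 t, w s b ≤ w t₀ a₀ := by
    intro b s hs
    by_cases hb : f b ≤ M / ε
    · exact hmaxK b hb s hs
    · exact ((hout s hs.1 b hb).trans hw₀).le
  have ht₀pos : 0 < t₀ := by
    refine lt_of_le_of_ne ht₀Icc.1 fun h => ?_
    rw [← h] at hw₀
    have := h0 a₀
    have h5 : 0 < ε * (Real.exp (C' * 0) * f a₀) := mul_pos hε (mul_pos (Real.exp_pos _) (hf a₀))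
    simp only [hw] at hw₀
    linarith
  have hd1 : HasDerivAt (fun s => ε * (Real.exp (C' * s) * f a₀))
      (ε * (Real.exp (C' * t₀) * C' * f a₀)) t₀ := by
    have := ((((hasDerivAt_id t₀).const_mul C').exp).mul_const (f a₀)).const_mul ε
    simpa using this
  have hd := (hderiv a₀ t₀ ht₀pos).sub hd1
  -- At a maximum over the states the generator applied to w is nonpositive, because the rows sum to
  -- zero; strictness comes from C'.
  have hdneg : ∑ c ∈ S a₀, Q a₀ c * u t₀ c - ε * (Real.exp (C' * t₀) * C' * f a₀) < 0 := by
    have h1 : ∑ c ∈ S a₀, Q a₀ c * u t₀ c = ∑ c ∈ S a₀, Q a₀ c * (w t₀ c - w t₀ a₀) +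
        ε * Real.exp (C' * t₀) * ∑ c ∈ S a₀, Q a₀ c * f c := by
      have h2 : ∑ c ∈ S a₀, Q a₀ c * (w t₀ c - w t₀ a₀) = ∑ c ∈ S a₀, Q a₀ c * w t₀ c := by
        simp only [mul_sub, Finset.sum_sub_distrib, ← Finset.sum_mul, hrow, zero_mul, sub_zero]
      rw [h2, Finset.mul_sum, ← Finset.sum_add_distrib]
      refine Finset.sum_congr rfl fun c _ => ?_
      simp only [hw]
      ring
    have h3 : ∑ c ∈ S a₀, Q a₀ c * (w t₀ c - w t₀ a₀) ≤ 0 := by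
      refine Finset.sum_nonpos fun c _ => ?_
      by_cases hc : c = a₀
      · simp [hc]
      · exact mul_nonpos_of_nonneg_of_nonpos (hoff a₀ c hc) (sub_nonpos.2 (hmaxall c t₀ ht₀Icc))
    have h4 : ∑ c ∈ S a₀, Q a₀ c * f c < C' * f a₀ := by
      refine (hlyap a₀).trans_lt (mul_lt_mul_of_pos_right ?_ (hf a₀))
      have := le_abs_self C
      linarith
    have h5 := mul_lt_mul_of_pos_left h4 (mul_pos hε (Real.exp_pos (C' * t₀)))
    rw [h1]
    linarith
  -- The maximum may sit at the right endpoint of [0, t], so only left slopes are used: they are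
  -- nonnegative, against the negative derivative.
  have hslope := (hasDerivAt_iff_tendsto_slope_left_right.1 hd).1
  refine hdneg.not_ge (ge_of_tendsto hslope ?_)
  have : Ioo 0 t₀ ∈ 𝓝[<] t₀ := Ioo_mem_nhdsLT ht₀pos
  filter_upwards [this] with s hs
  rw [slope_def_field]
  refine div_nonneg_of_nonpos ?_ (sub_nonpos.2 hs.2.le)
  have := hmaxall a₀ s ⟨hs.1.le, hs.2.le.trans ht₀Icc.2⟩
  exact sub_nonpos.2 this

/-- The Foster–Lyapunov criterion for regularity. -/
theorem isRegular_of_lyapunov [Countable A] (hS : ∀ a c, c ∉ S a → Q a c = 0)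
    (hoff : ∀ a c, c ≠ a → 0 ≤ Q a c) (hrow : ∀ a, ∑ c ∈ S a, Q a c = 0)
    {f : A → ℝ} (hf : ∀ a, 0 < f a) (hfin : ∀ r : ℝ, {a | f a ≤ r}.Finite) {C : ℝ}
    (hlyap : ∀ a, ∑ c ∈ S a, Q a c * f c ≤ C * f a) : IsRegular Q := by
  intro t ht a
  have hφ : ∀ a : A, (fun _ => 1 : A → ℝ≥0∞) a ≤ ENNReal.ofReal 1 := by simp
  -- The defect 1 - P(t)1 solves the backward equation with zero initial value.
  have h1 := nonpos_of_backward hoff hrow hf hfin hlyap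
    (u := fun t a => 1 - realAct Q (fun _ => 1) t a) (M := 1)
    (fun a => continuous_const.sub (continuous_realAct hS hoff hrow zero_le_one hφ a))
    (fun t a => sub_le_self _ (realAct_nonneg _ _))
    (fun a => by simp [realAct_zero a hS hoff hrow hφ])
    (fun a t ht => by
      refine ((hasDerivAt_realAct hS hoff hrow zero_le_one hφ a ht).const_sub 1).congr_deriv ?_
      simp [mul_sub, Finset.sum_sub_distrib, hrow]) ht a
  have h2 : realAct Q (fun _ => 1) t a = 1 :=
    le_antisymm (realAct_le hS hoff hrow zero_le_one hφ t a) (by linarith)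
  have h3 := ofReal_realAct hS hoff hrow hφ ht a
  rw [h2] at h3
  simpa [semigroupAct] using h3.symm

variable {B : Type*} [DecidableEq B]

/-- Two semigroups are intertwined by a link as soon as their matrices of rates are. -/
theorem comp_minimalSolution_eq [Countable A] [Countable B]
    (hS : ∀ a c, c ∉ S a → Q a c = 0)
    (hoff : ∀ a c, c ≠ a → 0 ≤ Q a c) (hrow : ∀ a, ∑ c ∈ S a, Q a c = 0)
    {f : A → ℝ} (hf : ∀ a, 0 < f a) (hfin : ∀ r : ℝ, {a | f a ≤ r}.Finite) {C : ℝ}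
    (hlyap : ∀ a, ∑ c ∈ S a, Q a c * f c ≤ C * f a)
    {R : B → B → ℝ} {S' : B → Finset B} (hS' : ∀ a c, c ∉ S' a → R a c = 0)
    (hoff' : ∀ a c, c ≠ a → 0 ≤ R a c) (hrow' : ∀ a, ∑ c ∈ S' a, R a c = 0)
    {K : A → B → ℝ} {T : A → Finset B} (hT : ∀ a b, b ∉ T a → K a b = 0)
    (hK : ∀ a b, 0 ≤ K a b) {M : ℝ} (hKM : ∀ a, ∑ b ∈ T a, K a b ≤ M)
    (hcomm : ∀ a b, ∑ c ∈ S a, Q a c * K c b = ∑ c ∈ T a, K a c * R c b) {t : ℝ} (ht : 0 ≤ t) :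
    comp (minimalSolution Q t) (fun a b => ENNReal.ofReal (K a b)) =
      comp (fun a b => ENNReal.ofReal (K a b)) (minimalSolution R t) := by
  funext a₁ b
  have hM0 : 0 ≤ M := (Finset.sum_nonneg fun c _ => hK a₁ c).trans (hKM a₁)
  have hKle : ∀ a, K a b ≤ M := by
    intro a
    by_cases hb : b ∈ T a
    · exact (Finset.single_le_sum (fun c _ => hK a c) hb).trans (hKM a)
    · rw [hT a b hb]; exact hM0
  set φ : A → ℝ≥0∞ := fun a => ENNReal.ofReal (K a b) with hφdef
  set ψ : B → ℝ≥0∞ := fun c => if c = b then 1 else 0 with hψdef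
  have hφ : ∀ a, φ a ≤ ENNReal.ofReal M := fun a => ENNReal.ofReal_le_ofReal (hKle a)
  have hψ : ∀ a, ψ a ≤ ENNReal.ofReal 1 := by
    intro c
    simp only [hψdef]
    split_ifs <;> simp
  -- Column b of the link followed by the semigroup of R. By `hcomm` it solves the backward equation
  -- of Q.
  set F : ℝ → A → ℝ := fun t a => ∑ c ∈ T a, K a c * realAct R ψ t c with hF
  have hFcont : ∀ a, Continuous fun t => F t a := fun a =>
    continuous_finsetSum _ fun c _ =>
      (continuous_realAct hS' hoff' hrow' zero_le_one hψ c).const_mul _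
  have hF0 : ∀ a, F 0 a = K a b := by
    intro a
    simp only [hF, realAct_zero _ hS' hoff' hrow' hψ]
    simp only [hψdef]
    by_cases hb : b ∈ T a
    · rw [Finset.sum_eq_single_of_mem b hb]
      · simp
      · intro c _ hc
        simp [hc]
    · rw [hT a b hb]
      refine Finset.sum_eq_zero fun c hc => ?_
      have : c ≠ b := fun h => hb (h ▸ hc)
      simp [this]
  have hFnonneg : ∀ t a, 0 ≤ F t a := fun t a =>
    Finset.sum_nonneg fun c _ => mul_nonneg (hK a c) (realAct_nonneg _ _)
  have hFle : ∀ t a, F t a ≤ M := fun t a =>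
    (Finset.sum_le_sum fun c _ => mul_le_of_le_one_right (hK a c)
      (realAct_le hS' hoff' hrow' zero_le_one hψ t c)).trans (hKM a)
  have hFderiv : ∀ a t, 0 < t → HasDerivAt (fun t => F t a) (∑ c ∈ S a, Q a c * F t c) t := by
    intro a t ht
    refine (HasDerivAt.fun_sum fun c _ => (hasDerivAt_realAct hS' hoff' hrow' zero_le_one hψ c
      ht).const_mul (K a c)).congr_deriv ?_
    -- A common finite support for both double sums, so that they can be interchanged and compared
    -- termwise.
    set U : Finset B := (T a).biUnion S' ∪ (S a).biUnion T with hU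
    have e1 : ∀ c ∈ T a, ∑ d ∈ S' c, R c d * realAct R ψ t d = ∑ d ∈ U, R c d * realAct R ψ t d := by
      intro c hc
      refine Finset.sum_subset ?_ fun d _ hd => by rw [hS' c d hd, zero_mul]
      exact (Finset.subset_biUnion_of_mem S' hc).trans Finset.subset_union_left
    have e2 : ∀ c ∈ S a, F t c = ∑ d ∈ U, K c d * realAct R ψ t d := by
      intro c hc
      refine Finset.sum_subset ?_ fun d _ hd => by rw [hT c d hd, zero_mul]
      exact (Finset.subset_biUnion_of_mem T hc).trans Finset.subset_union_right
    rw [Finset.sum_congr rfl fun c hc => congrArg (K a c * ·) (e1 c hc),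
      Finset.sum_congr rfl fun c hc => congrArg (Q a c * ·) (e2 c hc)]
    simp only [Finset.mul_sum]
    rw [Finset.sum_comm, Finset.sum_comm (s := S a)]
    refine Finset.sum_congr rfl fun d _ => ?_
    simp only [← mul_assoc, ← Finset.sum_mul, hcomm]
  have hgcont := continuous_realAct hS hoff hrow hM0 hφ
  have hgderiv := fun a t (ht : 0 < t) => hasDerivAt_realAct hS hoff hrow hM0 hφ a ht
  have hg0 : ∀ a, realAct Q φ 0 a = K a b := fun a => by
    rw [realAct_zero a hS hoff hrow hφ, ENNReal.toReal_ofReal (hK a b)]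
  have key1 := nonpos_of_backward hoff hrow hf hfin hlyap
    (u := fun t a => realAct Q φ t a - F t a) (M := M)
    (fun a => (hgcont a).sub (hFcont a))
    (fun t a => by linarith [realAct_le hS hoff hrow hM0 hφ t a, hFnonneg t a])
    (fun a => by simp [hg0, hF0])
    (fun a t ht => ((hgderiv a t ht).sub (hFderiv a t ht)).congr_deriv (by
      simp [mul_sub, Finset.sum_sub_distrib])) ht a₁
  have key2 := nonpos_of_backward hoff hrow hf hfin hlyap
    (u := fun t a => F t a - realAct Q φ t a) (M := M)
    (fun a => (hFcont a).sub (hgcont a))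
    (fun t a => by linarith [hFle t a, realAct_nonneg (Q := Q) (φ := φ) t a])
    (fun a => by simp [hg0, hF0])
    (fun a t ht => ((hFderiv a t ht).sub (hgderiv a t ht)).congr_deriv (by
      simp [mul_sub, Finset.sum_sub_distrib])) ht a₁
  have h1 : comp (minimalSolution Q t) (fun a b => ENNReal.ofReal (K a b)) a₁ b =
      ENNReal.ofReal (realAct Q φ t a₁) := (ofReal_realAct hS hoff hrow hφ ht a₁).symm
  have h2 : comp (fun a b => ENNReal.ofReal (K a b)) (minimalSolution R t) a₁ b =
      ENNReal.ofReal (F t a₁) := by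
    simp only [comp, hF]
    rw [ENNReal.ofReal_sum_of_nonneg fun c _ => mul_nonneg (hK a₁ c) (realAct_nonneg _ _),
      tsum_eq_sum (s := T a₁)]
    · refine Finset.sum_congr rfl fun c _ => ?_
      rw [ENNReal.ofReal_mul (hK a₁ c), ofReal_realAct hS' hoff' hrow' hψ ht c]
      simp only [semigroupAct, hψdef]
      rw [tsum_eq_single b]
      · simp
      · intro d hd
        simp [hd]
    · intro c hc
      simp [hT a₁ c hc]
  rw [h1, h2]
  congr 1
  linarith

end Chains

end GelfandTsetlin

namespace GelfandTsetlin

/-! ### One-particle operators acting on signatures and on alternants. -/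

section Combinatorics

variable {N : ℕ}

theorem coord_strictAnti (la : Signature N) : StrictAnti (coord la) := by
  intro i j hij
  have h1 := la.2 hij.le
  have h2 : ((i : ℕ) : ℤ) < ((j : ℕ) : ℤ) := by exact_mod_cast hij
  simp only [coord]
  omega

theorem coord_injective : Function.Injective (coord : Signature N → Fin N → ℤ) := by
  intro la nu h
  ext j
  have := congrFun h j
  simp only [coord] at this
  omega

theorem exists_coord_eq {x : Fin N → ℤ} (hx : StrictAnti x) : ∃ la : Signature N, coord la = x := by
  have key : ∀ d : ℕ, ∀ i j : Fin N, (j : ℕ) = i + d → x j + d ≤ x i := by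
    intro d
    induction d with
    | zero =>
      intro i j h
      have hji : j = i := Fin.ext (by simpa using h)
      simp [hji]
    | succ d ih =>
      intro i j h
      have h1 := ih i ⟨i + d, by omega⟩ rfl
      have h2 : x j < x ⟨i + d, by omega⟩ := hx (by simp [Fin.lt_def]; omega)
      push_cast
      omega
  refine ⟨⟨fun j => x j - N + 1 + (j : ℕ), fun i j hij => ?_⟩, ?_⟩
  · have := key (j - i) i j (by have : (i : ℕ) ≤ j := hij; omega)
    have h3 : (i : ℕ) ≤ j := hij
    push_cast [h3] at this
    simp only
    omega
  · funext j
    simp only [coord]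
    ring

/-- Moving one entry of a strictly decreasing integer tuple by at most one keeps it weakly
decreasing, so the chamber can only be left through a tuple with two equal entries. -/
theorem exists_coord_eq_update (la : Signature N) (j : Fin N) {y : ℤ}
    (hy : y ∈ Finset.Icc (coord la j - 1) (coord la j + 1))
    (hinj : Function.Injective (Function.update (coord la) j y)) :
    ∃ nu : Signature N, coord nu = Function.update (coord la) j y := by
  refine exists_coord_eq fun i k hik => ?_
  have hl := coord_strictAnti la hik
  have hne := hinj.ne hik.ne
  rw [Finset.mem_Icc] at hy
  by_cases hi : i = j
  · subst hi
    rw [Function.update_of_ne hik.ne', Function.update_self] at *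
    omega
  · by_cases hk : k = j
    · subst hk
      rw [Function.update_of_ne hik.ne, Function.update_self] at *
      omega
    · rwa [Function.update_of_ne hi, Function.update_of_ne hk]

/-- The tuples obtained from the coordinates of a signature by moving at most one of them by at
most one. -/
noncomputable def moves (la : Signature N) : Finset (Fin N → ℤ) :=
  insert (coord la) (Finset.univ.biUnion fun j =>
    (Finset.Icc (coord la j - 1) (coord la j + 1)).image (Function.update (coord la) j))

/-- A finite set of signatures that contains all those reachable in one jump. -/
noncomputable def neighbors (la : Signature N) : Finset (Signature N) :=
  (moves la).preimage coord coord_injective.injOn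

theorem self_mem_neighbors (la : Signature N) : la ∈ neighbors la := by
  simp [neighbors, moves]

/-- The matrix acting by the kernel `k` on one of the coordinates. -/
def coordKernel (k : ℤ → ℤ → ℝ) (la nu : Signature N) : ℝ :=
  ∑ j : Fin N, if ∀ i : Fin N, i ≠ j → coord la i = coord nu i
    then k (coord la j) (coord nu j) else 0

theorem eq_update_of_forall_ne {x y : Fin N → ℤ} {j : Fin N} (h : ∀ i, i ≠ j → x i = y i) :
    Function.update x j (y j) = y := by
  funext i
  by_cases hi : i = j
  · subst hi; simp
  · rw [Function.update_of_ne hi, h i hi]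

theorem coordKernel_eq_zero {k : ℤ → ℤ → ℝ} (hk : ∀ x y, y ∉ Finset.Icc (x - 1) (x + 1) → k x y = 0)
    {la nu : Signature N} (h : nu ∉ neighbors la) : coordKernel k la nu = 0 := by
  refine Finset.sum_eq_zero fun j _ => ?_
  split_ifs with hj
  · refine hk _ _ fun hmem => h ?_
    rw [neighbors, Finset.mem_preimage, moves, Finset.mem_insert]
    exact Or.inr (Finset.mem_biUnion.2 ⟨j, Finset.mem_univ _,
      Finset.mem_image.2 ⟨_, hmem, eq_update_of_forall_ne hj⟩⟩)
  · rfl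

/-- Functions that vanish on tuples with equal entries do not see the walls of the chamber. -/
theorem sum_coordKernel_mul {k : ℤ → ℤ → ℝ}
    (hk : ∀ x y, y ∉ Finset.Icc (x - 1) (x + 1) → k x y = 0)
    {Φ : (Fin N → ℤ) → ℝ} (hΦ : ∀ x, ¬ Function.Injective x → Φ x = 0) (la : Signature N) :
    ∑ nu ∈ neighbors la, coordKernel k la nu * Φ (coord nu) =
      ∑ j, ∑ y ∈ Finset.Icc (coord la j - 1) (coord la j + 1),
        k (coord la j) y * Φ (Function.update (coord la) j y) := by
  simp only [coordKernel, Finset.sum_mul]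
  rw [Finset.sum_comm]
  refine Finset.sum_congr rfl fun j _ => ?_
  set F : (Fin N → ℤ) → ℝ := fun x => (if ∀ i : Fin N, i ≠ j → coord la i = x i
    then k (coord la j) (x j) else 0) * Φ x with hF
  set I := Finset.Icc (coord la j - 1) (coord la j + 1) with hI
  have hsub : I.image (Function.update (coord la) j) ⊆ moves la :=
    (Finset.subset_biUnion_of_mem (fun j =>
      (Finset.Icc (coord la j - 1) (coord la j + 1)).image (Function.update (coord la) j))
      (Finset.mem_univ j)).trans (Finset.subset_insert _ _)
  have hout : ∀ x, x ∉ I.image (Function.update (coord la) j) → F x = 0 := by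
    intro x hx
    simp only [hF]
    split_ifs with h
    · rw [hk, zero_mul]
      exact fun hmem => hx (Finset.mem_image.2 ⟨_, hmem, eq_update_of_forall_ne h⟩)
    · rw [zero_mul]
  have hrange : ∀ x ∈ moves la, x ∉ Set.range (coord : Signature N → Fin N → ℤ) → F x = 0 := by
    intro x _ hx
    by_cases hmem : x ∈ I.image (Function.update (coord la) j)
    · obtain ⟨y, hy, rfl⟩ := Finset.mem_image.1 hmem
      simp only [hF]
      rw [hΦ, mul_zero]
      exact fun hinj => hx (exists_coord_eq_update la j hy hinj)
    · exact hout x hmem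
  have h1 : ∑ nu ∈ neighbors la, F (coord nu) = ∑ x ∈ moves la, F x :=
    Finset.sum_preimage coord (moves la) coord_injective.injOn F hrange
  refine h1.trans ?_
  rw [← Finset.sum_subset hsub fun x _ hx => hout x hx,
    Finset.sum_image (Function.update_injective _ _).injOn]
  refine Finset.sum_congr rfl fun y _ => ?_
  simp only [hF, Function.update_self]
  rw [if_pos]
  intro i hi
  rw [Function.update_of_ne hi]

/-- Summing over the replacement of one row is the same as over the replacement of one column. -/
theorem sum_det_updateRow {ι : Type*} [Fintype ι] [DecidableEq ι] (M M' : Matrix ι ι ℝ) :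
    ∑ i, (M.updateRow i (M' i)).det = ∑ c, (M.updateCol c fun i => M' i c).det := by
  -- Cofactor expansion: both sides equal the trace of adj(M) M'.
  have h1 : ∀ i, (M.updateRow i (M' i)).det = ∑ c, M.adjugate c i * M' i c := by
    intro i
    rw [← Matrix.cramer_transpose_apply, Matrix.cramer_eq_adjugate_mulVec,
      ← Matrix.adjugate_transpose]
    rfl
  have h2 : ∀ c, (M.updateCol c fun i => M' i c).det = ∑ i, M.adjugate c i * M' i c := by
    intro c
    rw [← Matrix.cramer_apply, Matrix.cramer_eq_adjugate_mulVec]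
    rfl
  simp only [h1, h2]
  exact Finset.sum_comm

/-- The alternant `det (g c (x i))`. -/
def alternant (g : Fin N → ℤ → ℝ) (x : Fin N → ℤ) : ℝ :=
  (Matrix.of fun i c => g c (x i)).det

theorem alternant_eq_zero (g : Fin N → ℤ → ℝ) (x : Fin N → ℤ) (hx : ¬ Function.Injective x) :
    alternant g x = 0 := by
  simp only [Function.Injective, not_forall] at hx
  obtain ⟨i, j, hij, hne⟩ := hx
  refine Matrix.det_zero_of_row_eq hne ?_
  funext c
  simp [hij]

/-- Acting on one particle changes one row; by multilinearity and the exchange of rows and columns,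
the total action applies the kernel to one function `g c` at a time. -/
theorem sum_kernel_mul_alternant (k : ℤ → ℤ → ℝ) (g : Fin N → ℤ → ℝ) (x : Fin N → ℤ) :
    ∑ j, ∑ y ∈ Finset.Icc (x j - 1) (x j + 1), k (x j) y * alternant g (Function.update x j y) =
      ∑ c, ((Matrix.of fun i c => g c (x i)).updateCol c fun i =>
        ∑ y ∈ Finset.Icc (x i - 1) (x i + 1), k (x i) y * g c y).det := by
  refine Eq.trans ?_ (sum_det_updateRow (Matrix.of fun i c => g c (x i)) (Matrix.of fun i c =>
    ∑ y ∈ Finset.Icc (x i - 1) (x i + 1), k (x i) y * g c y))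
  refine Finset.sum_congr rfl fun j _ => ?_
  have h1 : ∀ y, alternant g (Function.update x j y) =
      ((Matrix.of fun i c => g c (x i)).updateRow j fun c => g c y).det := by
    intro y
    rw [alternant]
    congr 1
    ext i c
    by_cases hi : i = j
    · subst hi; simp
    · simp [Matrix.updateRow_ne hi, Function.update_of_ne hi]
  simp only [h1, ← Matrix.cramer_transpose_apply]
  have h2 : (Matrix.of (fun i c => ∑ y ∈ Finset.Icc (x i - 1) (x i + 1), k (x i) y * g c y)) j =
      ∑ y ∈ Finset.Icc (x j - 1) (x j + 1), k (x j) y • fun c => g c y := by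
    funext c
    simp [Finset.sum_apply]
  rw [h2, map_sum, Finset.sum_apply]
  simp only [map_smul, Pi.smul_apply, smul_eq_mul]

end Combinatorics

end GelfandTsetlin

namespace GelfandTsetlin

open Polynomial

/-! ### The birth-death operator on polynomials. -/

section Generator

/-- `g` is a polynomial function of degree at most `m` with coefficient `c` in degree `m`. -/
def HasLeading (g : ℤ → ℝ) (m : ℕ) (c : ℝ) : Prop :=
  ∃ q : ℝ[X], q.natDegree ≤ m ∧ q.coeff m = c ∧ ∀ x : ℤ, g x = q.eval (x : ℝ)

theorem HasLeading.add {g h : ℤ → ℝ} {m : ℕ} {c d : ℝ} (hg : HasLeading g m c)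
    (hh : HasLeading h m d) : HasLeading (fun x => g x + h x) m (c + d) := by
  obtain ⟨p, hp, rfl, hpe⟩ := hg
  obtain ⟨q, hq, rfl, hqe⟩ := hh
  exact ⟨p + q, natDegree_add_le_of_degree_le hp hq, coeff_add _ _ _, fun x => by
    simp only [hpe, hqe, eval_add]⟩

theorem HasLeading.mul {g h : ℤ → ℝ} {m n : ℕ} {c d : ℝ} (hg : HasLeading g m c)
    (hh : HasLeading h n d) : HasLeading (fun x => g x * h x) (m + n) (c * d) := by
  obtain ⟨p, hp, rfl, hpe⟩ := hg
  obtain ⟨q, hq, rfl, hqe⟩ := hh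
  exact ⟨p * q, natDegree_mul_le_of_le hp hq, coeff_mul_add_eq_of_natDegree_le hp hq, fun x => by
    simp only [hpe, hqe, eval_mul]⟩

theorem HasLeading.succ {g : ℤ → ℝ} {m : ℕ} {c : ℝ} (hg : HasLeading g m c) :
    HasLeading g (m + 1) 0 := by
  obtain ⟨p, hp, -, hpe⟩ := hg
  exact ⟨p, hp.trans (Nat.le_succ _), coeff_eq_zero_of_natDegree_lt (Nat.lt_succ_of_le hp), hpe⟩

theorem hasLeading_pow (m : ℕ) : HasLeading (fun x => (x : ℝ) ^ m) m 1 :=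
  ⟨X ^ m, natDegree_X_pow_le m, by simp, fun x => by simp⟩

theorem hasLeading_quadratic (a b c : ℝ) :
    HasLeading (fun x => a * (x : ℝ) ^ 2 + b * x + c) 2 a :=
  ⟨C a * X ^ 2 + C b * X + C c, natDegree_quadratic_le, by simp,
    fun x => by simp⟩

theorem hasLeading_linear (a b : ℝ) : HasLeading (fun x => a * (x : ℝ) + b) 1 a :=
  ⟨C a * X + C b, natDegree_linear_le, by simp [coeff_C], fun x => by simp⟩

/-- The generator of the birth and death process with birth rates `b` and death rates `d`. -/
def bdGen (b d : ℤ → ℝ) (g : ℤ → ℝ) (x : ℤ) : ℝ :=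
  b x * (g (x + 1) - g x) + d x * (g (x - 1) - g x)

/-- Let L be the generator and E f = b f(x+1) - d f(x-1). Then L(x f) = x L f + E f and E(x f) = x E
f + L f + (b + d) f, which makes a joint induction close. The equal quadratic parts of b and d keep
E to one extra degree. -/
theorem hasLeading_bdGen_pow {b d : ℤ → ℝ} {b₁ b₀ d₁ d₀ : ℝ}
    (hb : ∀ x : ℤ, b x = (x : ℝ) ^ 2 - b₁ * x + b₀) (hd : ∀ x : ℤ, d x = (x : ℝ) ^ 2 + d₁ * x + d₀)
    (m : ℕ) :
    HasLeading (bdGen b d fun x => (x : ℝ) ^ m) m (m * (m - 1) - (b₁ + d₁) * m) := by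
  suffices h : HasLeading (bdGen b d fun x => (x : ℝ) ^ m) m (m * (m - 1) - (b₁ + d₁) * m) ∧
      HasLeading (fun x : ℤ => b x * ((x + 1 : ℤ) : ℝ) ^ m - d x * ((x - 1 : ℤ) : ℝ) ^ m) (m + 1)
        (2 * m - (b₁ + d₁)) from h.1
  induction m with
  | zero =>
    refine ⟨⟨0, by simp, by simp, fun x => by simp [bdGen]⟩, ?_⟩
    convert hasLeading_linear (2 * ((0 : ℕ) : ℝ) - (b₁ + d₁)) (b₀ - d₀) using 2 with x
    rw [hb, hd]
    push_cast
    ring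
  | succ m ih =>
    obtain ⟨ih1, ih2⟩ := ih
    have hx := hasLeading_linear 1 0
    have hbd := hasLeading_quadratic 2 (d₁ - b₁) (b₀ + d₀)
    constructor
    · have h := (hx.mul ih1).add (d := 2 * m - (b₁ + d₁)) (m := 1 + m) (by rwa [add_comm])
      rw [add_comm 1 m] at h
      convert h using 2 with x
      · simp only [bdGen]
        push_cast
        ring
      · push_cast
        ring
    · have h := ((hx.mul ih2).add (m := 1 + (m + 1)) (by
        rw [add_comm]; exact ih1.succ.succ)).add (m := 1 + (m + 1)) (by
        have := hbd.mul (hasLeading_pow m)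
        rwa [show 2 + m = 1 + (m + 1) by ring] at this)
      rw [add_comm 1 (m + 1)] at h
      convert h using 2 with x
      · simp only [bdGen, hb, hd]
        push_cast
        ring
      · push_cast
        ring

theorem sum_Icc_three (x : ℤ) (f : ℤ → ℝ) :
    ∑ y ∈ Finset.Icc (x - 1) (x + 1), f y = f (x - 1) + f x + f (x + 1) := by
  have : Finset.Icc (x - 1) (x + 1) = {x - 1, x, x + 1} := by
    ext y
    simp only [Finset.mem_Icc, Finset.mem_insert, Finset.mem_singleton]
    omega
  rw [this, Finset.sum_insert (by simp; omega), Finset.sum_insert (by simp), Finset.sum_singleton]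
  ring

theorem bdRate_eq_zero (u u' v v' : ℂ) (x y : ℤ) (h : y ∉ Finset.Icc (x - 1) (x + 1)) :
    bdRate u u' v v' x y = 0 := by
  rw [Finset.mem_Icc] at h
  rw [bdRate, if_neg (by omega), if_neg (by omega), if_neg (by omega)]

/-- The birth rates. -/
noncomputable def birth (u u' : ℂ) (x : ℤ) : ℝ := ((x - u) * (x - u')).re

/-- The death rates. -/
noncomputable def death (v v' : ℂ) (x : ℤ) : ℝ := ((x + v) * (x + v')).re

theorem birth_eq (u u' : ℂ) (x : ℤ) :
    birth u u' x = (x : ℝ) ^ 2 - (u + u').re * x + (u * u').re := by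
  simp [birth]
  ring

theorem death_eq (v v' : ℂ) (x : ℤ) :
    death v v' x = (x : ℝ) ^ 2 + (v + v').re * x + (v * v').re := by
  simp [death]
  ring

theorem sum_bdRate_mul (u u' v v' : ℂ) (g : ℤ → ℝ) (x : ℤ) :
    ∑ y ∈ Finset.Icc (x - 1) (x + 1), bdRate u u' v v' x y * g y =
      bdGen (birth u u') (death v v') g x := by
  rw [sum_Icc_three]
  have h1 : bdRate u u' v v' x (x - 1) = death v v' x := by
    rw [bdRate, if_neg (by omega), if_pos rfl, death]
  have h2 : bdRate u u' v v' x x = -birth u u' x - death v v' x := by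
    rw [bdRate, if_neg (by omega), if_neg (by omega), if_pos rfl, birth, death]
  have h3 : bdRate u u' v v' x (x + 1) = birth u u' x := by
    rw [bdRate, if_pos rfl, birth]
  rw [h1, h2, h3, bdGen]
  ring

end Generator

/-! ### Conjugation by the Vandermonde determinant; zero row sums. -/

section Vandermonde

variable {N : ℕ}

/-- The Vandermonde determinant of a tuple of integers. -/
def vand (x : Fin N → ℤ) : ℝ := alternant (fun c y => (y : ℝ) ^ (c : ℕ)) x

theorem vand_eq (x : Fin N → ℤ) :
    vand x = ∏ i : Fin N, ∏ j ∈ Finset.Ioi i, ((x j : ℝ) - x i) :=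
  Matrix.det_vandermonde (fun i => (x i : ℝ))

theorem vandermonde_pos (la : Signature N) : 0 < vandermonde la :=
  Finset.prod_pos fun i _ => Finset.prod_pos fun j hj => by
    have := coord_strictAnti la (Finset.mem_Ioi.1 hj)
    exact_mod_cast sub_pos.2 this

theorem vandermonde_eq_mul_vand (la : Signature N) :
    vandermonde la = (∏ i : Fin N, ∏ _j ∈ Finset.Ioi i, (-1 : ℝ)) * vand (coord la) := by
  rw [vand_eq, vandermonde, ← Finset.prod_mul_distrib]
  refine Finset.prod_congr rfl fun i _ => ?_
  rw [← Finset.prod_mul_distrib]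
  refine Finset.prod_congr rfl fun j _ => ?_
  push_cast
  ring

theorem vand_coord_ne_zero (la : Signature N) : vand (coord la) ≠ 0 := by
  have h := (vandermonde_pos la).ne'
  rw [vandermonde_eq_mul_vand] at h
  exact right_ne_zero_of_mul h

theorem vandermonde_div (la nu : Signature N) :
    vandermonde nu / vandermonde la = vand (coord nu) / vand (coord la) := by
  have h := (vandermonde_pos la).ne'
  rw [vandermonde_eq_mul_vand] at h
  rw [vandermonde_eq_mul_vand, vandermonde_eq_mul_vand la,
    mul_div_mul_left _ _ (left_ne_zero_of_mul h)]

theorem dim_div (la nu : Signature N) : dim nu / dim la = vandermonde nu / vandermonde la := by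
  rw [dim, dim, div_div_div_cancel_right₀]
  exact Finset.prod_ne_zero_iff.2 fun i _ => by exact_mod_cast Nat.factorial_ne_zero i

theorem gtRate_eq (u u' v v' : ℂ) (la nu : Signature N) :
    gtRate N u u' v v' la nu = vandermonde nu / vandermonde la *
      coordKernel (bdRate u u' v v') la nu - if la = nu then dConst N u u' v v' else 0 := by
  rw [gtRate, dim_div]
  rfl

theorem gtRate_eq_zero (u u' v v' : ℂ) (la nu : Signature N) (h : nu ∉ neighbors la) :
    gtRate N u u' v v' la nu = 0 := by
  rw [gtRate_eq, coordKernel_eq_zero (bdRate_eq_zero u u' v v') h, if_neg]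
  · ring
  · rintro rfl
    exact h (self_mem_neighbors la)

/-- The rates act on a ratio of an alternant by the Vandermonde determinant. -/
theorem sum_gtRate_mul (u u' v v' : ℂ) (la : Signature N) (f : Signature N → ℝ)
    (g : Fin N → ℤ → ℝ) (hf : ∀ nu, vand (coord nu) * f nu = alternant g (coord nu)) :
    ∑ nu ∈ neighbors la, gtRate N u u' v v' la nu * f nu =
      (∑ c, ((Matrix.of fun i c => g c (coord la i)).updateCol c fun i =>
        bdGen (birth u u') (death v v') (g c) (coord la i)).det) / vand (coord la)
        - dConst N u u' v v' * f la := by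
  have h1 : ∀ nu, gtRate N u u' v v' la nu * f nu =
      coordKernel (bdRate u u' v v') la nu * alternant g (coord nu) / vand (coord la) -
        if la = nu then dConst N u u' v v' * f la else 0 := by
    intro nu
    rw [gtRate_eq, ← hf, vandermonde_div]
    split_ifs with h
    · subst h; ring
    · ring
  simp only [h1, Finset.sum_sub_distrib, ← Finset.sum_div]
  rw [sum_coordKernel_mul (bdRate_eq_zero u u' v v') (alternant_eq_zero g),
    sum_kernel_mul_alternant, Finset.sum_ite_eq, if_pos (self_mem_neighbors la)]
  simp only [sum_bdRate_mul]

theorem eval_eq_sum_fin {q : ℝ[X]} (hq : q.natDegree < N) (x : ℝ) :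
    q.eval x = ∑ r : Fin N, q.coeff r • x ^ (r : ℕ) := by
  rw [eval_eq_sum_range' hq, Finset.sum_range]
  rfl

theorem sum_eigenvalues (s : ℝ) (N : ℕ) :
    ∑ c : Fin N, (((c : ℕ) : ℝ) * ((c : ℕ) - 1) - s * (c : ℕ)) =
      (N : ℝ) * (N - 1) * (N - 2) / 3 - s * ((N : ℝ) * (N - 1) / 2) := by
  rw [← Finset.sum_range fun c : ℕ => ((c : ℝ) * (c - 1) - s * c)]
  induction N with
  | zero => simp
  | succ n ih =>
    rw [Finset.sum_range_succ, ih]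
    push_cast
    ring

/-- The image of y^c is a combination of y^r with r ≤ c; all but the diagonal term repeat another
column. Columns beyond c are left arbitrary so that this also applies when the last monomial is
changed. -/
theorem det_updateCol_bdGen_pow (u u' v v' : ℂ) (x : Fin N → ℤ) (g : Fin N → ℤ → ℝ) (c : Fin N)
    (hg : ∀ r ≤ c, g r = fun y : ℤ => (y : ℝ) ^ (r : ℕ)) :
    ((Matrix.of fun i c => g c (x i)).updateCol c fun i =>
        bdGen (birth u u') (death v v') (g c) (x i)).det =
      (((c : ℕ) : ℝ) * ((c : ℕ) - 1) - (u + u' + v + v').re * (c : ℕ)) * alternant g x := by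
  obtain ⟨q, hq, hqc, hqe⟩ := hasLeading_bdGen_pow (birth_eq u u') (death_eq v v') c
  have h1 : (fun i => bdGen (birth u u') (death v v') (g c) (x i)) =
      fun i => ∑ r : Fin N, q.coeff r • (Matrix.of fun i c => g c (x i)) i r := by
    funext i
    rw [hg c le_rfl, hqe, eval_eq_sum_fin (hq.trans_lt c.2)]
    refine Finset.sum_congr rfl fun r _ => ?_
    by_cases hr : r ≤ c
    · simp [hg r hr]
    · rw [coeff_eq_zero_of_natDegree_lt (hq.trans_lt (not_le.1 hr)), zero_smul, zero_smul]
  rw [h1, Matrix.det_updateCol_sum, hqc, alternant, smul_eq_mul]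
  congr 3
  simp only [Complex.add_re]
  ring

theorem sum_gtRate (u u' v v' : ℂ) (la : Signature N) :
    ∑ nu ∈ neighbors la, gtRate N u u' v v' la nu = 0 := by
  have h := sum_gtRate_mul u u' v v' la (fun _ => 1) (fun c y => (y : ℝ) ^ (c : ℕ))
    fun nu => mul_one _
  simp only [mul_one] at h
  rw [h, Finset.sum_congr rfl fun c _ => det_updateCol_bdGen_pow u u' v v' (coord la)
    (fun c (y : ℤ) => (y : ℝ) ^ (c : ℕ)) c fun _ _ => rfl, ← Finset.sum_mul, sum_eigenvalues]
  change _ * vand (coord la) / vand (coord la) - _ = 0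
  rw [mul_div_cancel_right₀ _ (vand_coord_ne_zero la), dConst, sub_self]

end Vandermonde

end GelfandTsetlin

namespace GelfandTsetlin

open Polynomial

/-! ### The Lyapunov function from the complete symmetric function of degree two. -/

section Lyapunov

/-- The two factors X shift the top three coefficients to indices free of natural-number
subtraction, even for fewer than two roots. -/
theorem coeff_prod_X_sub_C {ι : Type*} (x : ι → ℝ) (s : Finset ι) :
    (∏ i ∈ s, (X - C (x i))).natDegree ≤ s.card ∧
      (X * (X * ∏ i ∈ s, (X - C (x i)))).coeff (s.card + 2) = 1 ∧
      (X * (X * ∏ i ∈ s, (X - C (x i)))).coeff (s.card + 1) = -∑ i ∈ s, x i ∧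
      (X * (X * ∏ i ∈ s, (X - C (x i)))).coeff s.card =
        ((∑ i ∈ s, x i) ^ 2 - ∑ i ∈ s, x i ^ 2) / 2 := by
  classical
  induction s using Finset.induction_on with
  | empty => simp [← pow_two, coeff_X_pow]
  | insert a s ha ih =>
    obtain ⟨ih0, ih1, ih2, ih3⟩ := ih
    have hdeg : (X * (X * ∏ i ∈ s, (X - C (x i)))).natDegree ≤ s.card + 2 := by
      refine natDegree_mul_le.trans ?_
      have := (natDegree_mul_le (p := X) (q := ∏ i ∈ s, (X - C (x i)))).trans
        (Nat.add_le_add natDegree_X_le ih0)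
      have h2 := natDegree_X_le (R := ℝ)
      omega
    have h4 : (X * (X * ∏ i ∈ s, (X - C (x i)))).coeff (s.card + 1 + 2) = 0 :=
      coeff_eq_zero_of_natDegree_lt (by omega)
    have hstep : X * (X * ∏ i ∈ insert a s, (X - C (x i))) =
        X * (X * (X * ∏ i ∈ s, (X - C (x i)))) -
          C (x a) * (X * (X * ∏ i ∈ s, (X - C (x i)))) := by
      rw [Finset.prod_insert ha]
      ring
    rw [hstep, Finset.card_insert_of_notMem ha, Finset.sum_insert ha, Finset.sum_insert ha]
    refine ⟨?_, ?_, ?_, ?_⟩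
    · rw [Finset.prod_insert ha]
      refine natDegree_mul_le.trans ?_
      rw [natDegree_X_sub_C]
      omega
    · rw [coeff_sub, coeff_X_mul, coeff_C_mul, h4, show s.card + 1 + 1 = s.card + 2 from rfl, ih1]
      ring
    · rw [coeff_sub, coeff_X_mul, coeff_C_mul, show s.card + 1 + 1 = s.card + 2 from rfl, ih1, ih2]
      ring
    · rw [coeff_sub, coeff_X_mul, coeff_C_mul, ih2, ih3]
      ring

variable {n : ℕ}

/-- The Vandermonde determinant with the last column replaced. -/
noncomputable def vandLast (x : Fin (n + 1) → ℤ) (f : ℤ → ℝ) : ℝ :=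
  ((Matrix.of fun i (c : Fin (n + 1)) => (x i : ℝ) ^ (c : ℕ)).updateCol (Fin.last n)
    fun i => f (x i)).det

theorem vandLast_add (x : Fin (n + 1) → ℤ) (f g : ℤ → ℝ) :
    vandLast x (fun y => f y + g y) = vandLast x f + vandLast x g :=
  Matrix.det_updateCol_add _ _ (fun i => f (x i)) (fun i => g (x i))

theorem vandLast_smul (x : Fin (n + 1) → ℤ) (a : ℝ) (f : ℤ → ℝ) :
    vandLast x (fun y => a * f y) = a * vandLast x f :=
  Matrix.det_updateCol_smul _ _ a (fun i => f (x i))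

theorem vandLast_eval (x : Fin (n + 1) → ℤ) {q : ℝ[X]} (hq : q.natDegree ≤ n) {f : ℤ → ℝ}
    (hf : ∀ i, f (x i) = q.eval (x i : ℝ)) : vandLast x f = q.coeff n * vand x := by
  have h := Matrix.det_updateCol_sum (Matrix.of fun i (c : Fin (n + 1)) => (x i : ℝ) ^ (c : ℕ))
    (Fin.last n) fun r => q.coeff r
  rw [Fin.val_last, smul_eq_mul] at h
  rw [vandLast, vand, alternant, ← h]
  congr 2
  funext i
  rw [hf, eval_eq_sum_fin (Nat.lt_succ_of_le hq)]
  rfl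

/-- Only values at the nodes matter, so y^(n+1) may be reduced modulo the product of the y - x_i;
the remainder has leading coefficient h_1. -/
theorem vandLast_pow_succ (x : Fin (n + 1) → ℤ) :
    vandLast x (fun y => (y : ℝ) ^ (n + 1)) = (∑ i, (x i : ℝ)) * vand x := by
  obtain ⟨h0, h1, h2, -⟩ := coeff_prod_X_sub_C (fun i => (x i : ℝ)) Finset.univ
  simp only [coeff_X_mul, Finset.card_univ, Fintype.card_fin] at h0 h1 h2
  have hq : (X ^ (n + 1) - ∏ i, (X - C (x i : ℝ))).natDegree ≤ n := by
    rw [natDegree_le_iff_coeff_eq_zero]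
    intro k hk
    rcases Nat.eq_or_lt_of_le (Nat.succ_le_of_lt hk) with h | h
    · rw [← h, coeff_sub, coeff_X_pow, if_pos rfl, h1, sub_self]
    · rw [coeff_sub, coeff_X_pow, if_neg (by omega),
        coeff_eq_zero_of_natDegree_lt (h0.trans_lt h), sub_zero]
  rw [vandLast_eval x hq, coeff_sub, coeff_X_pow, if_neg (by omega), h2]
  · ring
  · intro i
    rw [eval_sub, eval_prod, Finset.prod_eq_zero (Finset.mem_univ i) (by simp)]
    simp

theorem vandLast_pow_add_two (x : Fin (n + 1) → ℤ) :
    vandLast x (fun y => (y : ℝ) ^ (n + 2)) =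
      ((∑ i, (x i : ℝ)) ^ 2 + ∑ i, (x i : ℝ) ^ 2) / 2 * vand x := by
  obtain ⟨h0, h1, h2, h3⟩ := coeff_prod_X_sub_C (fun i => (x i : ℝ)) Finset.univ
  simp only [coeff_X_mul, Finset.card_univ, Fintype.card_fin] at h0 h1 h2 h3
  -- The quotient of X^(n+2) by the product is X + h_1, and the remainder has top coefficient e_1² -
  -- e_2 = h_2.
  have hq : (X ^ (n + 2) - X * ∏ i, (X - C (x i : ℝ)) -
      C (∑ i, (x i : ℝ)) * ∏ i, (X - C (x i : ℝ))).natDegree ≤ n := by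
    rw [natDegree_le_iff_coeff_eq_zero]
    intro k hk
    obtain ⟨k, rfl⟩ : ∃ l, k = l + 1 := ⟨k - 1, by omega⟩
    rw [coeff_sub, coeff_sub, coeff_X_pow, coeff_X_mul, coeff_C_mul]
    rcases Nat.eq_or_lt_of_le (Nat.le_of_lt_succ hk) with h | h
    · rw [← h, if_neg (by omega), h1, h2]
      ring
    · rw [coeff_eq_zero_of_natDegree_lt (n := k + 1) (h0.trans_lt (by omega))]
      rcases Nat.eq_or_lt_of_le (Nat.succ_le_of_lt h) with h' | h'
      · rw [← h', if_pos rfl, h1]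
        ring
      · rw [if_neg (by omega), coeff_eq_zero_of_natDegree_lt (h0.trans_lt h')]
        ring
  rw [vandLast_eval x hq, coeff_sub, coeff_sub, coeff_X_pow, if_neg (by omega), coeff_C_mul, h2, h3]
  · ring
  · intro i
    rw [eval_sub, eval_sub, eval_mul, eval_mul, eval_prod,
      Finset.prod_eq_zero (Finset.mem_univ i) (by simp)]
    simp

/-- The monomials defining the alternant of the complete symmetric function of degree two. -/
noncomputable def shiftedMonomials (n : ℕ) (c : Fin (n + 1)) (y : ℤ) : ℝ :=
  if c = Fin.last n then (y : ℝ) ^ (n + 2) else (y : ℝ) ^ (c : ℕ)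

theorem updateCol_shiftedMonomials (x : Fin (n + 1) → ℤ) (f : Fin (n + 1) → ℝ) :
    (Matrix.of fun i c => shiftedMonomials n c (x i)).updateCol (Fin.last n) f =
      (Matrix.of fun i (c : Fin (n + 1)) => (x i : ℝ) ^ (c : ℕ)).updateCol (Fin.last n) f := by
  ext i c
  by_cases hc : c = Fin.last n
  · subst hc; simp
  · simp [shiftedMonomials, hc]

theorem alternant_shiftedMonomials (x : Fin (n + 1) → ℤ) :
    alternant (shiftedMonomials n) x =
      ((∑ i, (x i : ℝ)) ^ 2 + ∑ i, (x i : ℝ) ^ 2) / 2 * vand x := by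
  rw [← vandLast_pow_add_two, vandLast, ← updateCol_shiftedMonomials, alternant]
  congr 1
  ext i c
  by_cases hc : c = Fin.last n
  · subst hc; simp [shiftedMonomials]
  · simp [Matrix.updateCol_ne hc]

/-- A Lyapunov function. -/
noncomputable def lyapunov (la : Signature (n + 1)) : ℝ :=
  1 + (∑ i, (coord la i : ℝ)) ^ 2 + ∑ i, (coord la i : ℝ) ^ 2

theorem lyapunov_pos (la : Signature (n + 1)) : 0 < lyapunov la := by
  have : 0 ≤ ∑ i, (coord la i : ℝ) ^ 2 := Finset.sum_nonneg fun i _ => sq_nonneg _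
  rw [lyapunov]
  positivity

theorem finite_lyapunov_le (r : ℝ) : {la : Signature (n + 1) | lyapunov la ≤ r}.Finite := by
  have h1 : {x : Fin (n + 1) → ℤ | ∀ i, x i ∈ Set.Icc (-⌊r⌋) ⌊r⌋}.Finite :=
    Set.Finite.pi' fun _ => Set.finite_Icc _ _
  refine (h1.preimage (coord_injective.injOn (s := _))).subset fun la hla i => ?_
  have h2 : (coord la i : ℝ) ^ 2 ≤ ∑ i, (coord la i : ℝ) ^ 2 :=
    Finset.single_le_sum (f := fun i => (coord la i : ℝ) ^ 2) (fun i _ => sq_nonneg _)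
      (Finset.mem_univ i)
  have h3 : ((coord la i ^ 2 : ℤ) : ℝ) ≤ r := by
    push_cast
    have : lyapunov la ≤ r := hla
    rw [lyapunov] at this
    linarith [sq_nonneg (∑ i, (coord la i : ℝ))]
  have h4 := Int.le_floor.2 h3
  have h5 : |coord la i| ≤ coord la i ^ 2 := by
    rw [← sq_abs]
    exact Int.le_self_sq _
  exact abs_le.1 (h5.trans h4)

/-- The columns below the last contribute their eigenvalues times h_2. In the image of y^(n+2) the
powers n+2, n+1 and n give h_2, h_1 and 1, and lower powers repeat columns. -/
theorem exists_sum_gtRate_mul_lyapunov_le (n : ℕ) (u u' v v' : ℂ) :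
    ∃ C : ℝ, ∀ la : Signature (n + 1),
      ∑ nu ∈ neighbors la, gtRate (n + 1) u u' v v' la nu * lyapunov nu ≤ C * lyapunov la := by
  obtain ⟨q, hq, -, hqe⟩ := hasLeading_bdGen_pow (birth_eq u u') (death_eq v v') (n + 2)
  set e : ℝ := ∑ c : Fin n,
    (((c : ℕ) : ℝ) * ((c : ℕ) - 1) - (u + u' + v + v').re * (c : ℕ)) with he
  set A : ℝ := e + q.coeff (n + 2) - dConst (n + 1) u u' v v' with hA
  -- The image of `lyapunov` is A(p₁² + p₂) + 2 q_(n+1) p₁ + 2 q_n, and |p₁| ≤ 1 + p₁².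
  refine ⟨|A| + 2 * |q.coeff (n + 1)| + 2 * |q.coeff n|, fun la => ?_⟩
  set x := coord la with hx
  set p₁ : ℝ := ∑ i, (x i : ℝ) with hp₁
  set p₂ : ℝ := ∑ i, (x i : ℝ) ^ 2 with hp₂
  have hp₂0 : 0 ≤ p₂ := Finset.sum_nonneg fun i _ => sq_nonneg _
  have h1 := sum_gtRate_mul u u' v v' la
    (fun nu => ((∑ i, (coord nu i : ℝ)) ^ 2 + ∑ i, (coord nu i : ℝ) ^ 2) / 2)
    (shiftedMonomials n) fun nu => by rw [alternant_shiftedMonomials, mul_comm]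
  have hcast : ∀ c : Fin n, ((Matrix.of fun i c => shiftedMonomials n c (x i)).updateCol c.castSucc
      fun i => bdGen (birth u u') (death v v') (shiftedMonomials n c.castSucc) (x i)).det =
      (((c : ℕ) : ℝ) * ((c : ℕ) - 1) - (u + u' + v + v').re * (c : ℕ)) *
        ((p₁ ^ 2 + p₂) / 2 * vand x) := by
    intro c
    rw [det_updateCol_bdGen_pow, alternant_shiftedMonomials, Fin.val_castSucc]
    · intro r hr
      have hne : r ≠ Fin.last n := (hr.trans_lt (Fin.castSucc_lt_last c)).ne
      funext y
      rw [shiftedMonomials, if_neg hne]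
  have hlast : ((Matrix.of fun i c => shiftedMonomials n c (x i)).updateCol (Fin.last n)
      fun i => bdGen (birth u u') (death v v') (shiftedMonomials n (Fin.last n)) (x i)).det =
      q.coeff (n + 2) * ((p₁ ^ 2 + p₂) / 2 * vand x) + q.coeff (n + 1) * (p₁ * vand x) +
        q.coeff n * vand x := by
    have hmon : shiftedMonomials n (Fin.last n) = fun y : ℤ => (y : ℝ) ^ (n + 2) := by
      funext y
      rw [shiftedMonomials, if_pos rfl]
    have hr : (q - C (q.coeff (n + 2)) * X ^ (n + 2) -
        C (q.coeff (n + 1)) * X ^ (n + 1)).natDegree ≤ n := by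
      rw [natDegree_le_iff_coeff_eq_zero]
      intro k hk
      rw [coeff_sub, coeff_sub, coeff_C_mul_X_pow, coeff_C_mul_X_pow]
      by_cases hk1 : k = n + 1
      · subst hk1; simp
      · by_cases hk2 : k = n + 2
        · subst hk2; simp
        · rw [if_neg hk2, if_neg hk1, coeff_eq_zero_of_natDegree_lt (by omega)]
          simp
    have hval := vandLast_eval x hr (f := fun y => (q - C (q.coeff (n + 2)) * X ^ (n + 2) -
        C (q.coeff (n + 1)) * X ^ (n + 1)).eval (y : ℝ)) fun _ => rfl
    rw [coeff_sub, coeff_sub, coeff_C_mul_X_pow, coeff_C_mul_X_pow, if_neg (by omega),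
      if_neg (by omega), sub_zero, sub_zero] at hval
    rw [updateCol_shiftedMonomials, hmon, ← hval, ← vandLast_pow_add_two, ← vandLast_pow_succ,
      ← vandLast_smul, ← vandLast_smul, ← vandLast_add, ← vandLast_add, vandLast]
    congr 2
    funext i
    rw [hqe]
    simp
  rw [Fin.sum_univ_castSucc, hlast, Finset.sum_congr rfl fun c _ => hcast c, ← Finset.sum_mul,
    ← he] at h1
  have h2 : ∑ nu ∈ neighbors la, gtRate (n + 1) u u' v v' la nu * lyapunov nu =
      2 * (A * ((p₁ ^ 2 + p₂) / 2) + q.coeff (n + 1) * p₁ + q.coeff n) := by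
    have h3 : ∀ nu, gtRate (n + 1) u u' v v' la nu * lyapunov nu =
        gtRate (n + 1) u u' v v' la nu + 2 * (gtRate (n + 1) u u' v v' la nu *
          (((∑ i, (coord nu i : ℝ)) ^ 2 + ∑ i, (coord nu i : ℝ) ^ 2) / 2)) := by
      intro nu
      rw [lyapunov]
      ring
    simp only [h3, Finset.sum_add_distrib, ← Finset.mul_sum]
    rw [sum_gtRate, h1]
    have hv := vand_coord_ne_zero la
    rw [← hx] at hv ⊢
    field_simp
    rw [hA]
    ring
  rw [h2, lyapunov]
  have i1 : A * (p₁ ^ 2 + p₂) ≤ |A| * (p₁ ^ 2 + p₂) :=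
    mul_le_mul_of_nonneg_right (le_abs_self A) (by positivity)
  have i2 : q.coeff (n + 1) * p₁ ≤ |q.coeff (n + 1)| * (1 + p₁ ^ 2) := by
    refine (le_abs_self _).trans ?_
    rw [abs_mul]
    refine mul_le_mul_of_nonneg_left ?_ (abs_nonneg _)
    rw [← sq_abs]
    nlinarith [sq_nonneg (|p₁| - 1), abs_nonneg p₁]
  have i3 := le_abs_self (q.coeff n)
  have i4 : 0 ≤ |q.coeff (n + 1)| * p₂ := by positivity
  have i5 : 0 ≤ |q.coeff n| * (p₁ ^ 2 + p₂) := by positivity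
  nlinarith [abs_nonneg A]

end Lyapunov

end GelfandTsetlin

namespace GelfandTsetlin

/-! ### The links: interlacing determinant and intertwining of the rates. -/

section Link

variable {N : ℕ}

/-- The shift of coordinates is one larger on the upper level, so one inequality becomes strict and
each lower point lies in a half-open interval between upper neighbours. -/
theorem interlaces_iff (nu : Signature N) (la : Signature (N + 1)) :
    Interlaces nu la ↔ ∀ j : Fin N, coord la j.succ ≤ coord nu j ∧
      coord nu j < coord la j.castSucc := by
  refine forall_congr' fun j => ?_
  simp only [coord, Fin.val_succ, Fin.val_castSucc]
  push_cast
  constructor <;> intro h <;> constructor <;> omega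

/-- The columns of the determinant that detects interlacing. -/
def interlacingColumns (x : Fin N → ℤ) (c : Fin (N + 1)) (y : ℤ) : ℝ :=
  Fin.snoc (α := fun _ => ℝ) (fun j => if x j < y then 1 else 0) 1 c

@[simp]
theorem interlacingColumns_castSucc (x : Fin N → ℤ) (j : Fin N) (y : ℤ) :
    interlacingColumns x j.castSucc y = if x j < y then 1 else 0 := by
  rw [interlacingColumns, Fin.snoc_castSucc]

@[simp]
theorem interlacingColumns_last (x : Fin N → ℤ) (y : ℤ) :
    interlacingColumns x (Fin.last N) y = 1 := by
  rw [interlacingColumns, Fin.snoc_last]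

/-- The interlacing relation as a determinant. -/
theorem alternant_interlacingColumns (nu : Signature N) (la : Signature (N + 1)) :
    alternant (interlacingColumns (coord nu)) (coord la) = if Interlaces nu la then 1 else 0 := by
  have hl := coord_strictAnti la
  have hn := coord_strictAnti nu
  split_ifs with h
  · rw [interlaces_iff] at h
    rw [alternant, Matrix.det_of_isUpperTriangular]
    · refine Finset.prod_eq_one fun c _ => ?_
      induction c using Fin.lastCases with
      | last => simp
      | cast j => simp [(h j).2]
    · intro i c hci
      simp only [id] at hci
      induction c using Fin.lastCases with
      | last => exact absurd hci (Fin.le_last i).not_gt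
      | cast j =>
        have h1 : coord la i ≤ coord la j.succ := hl.antitone (by
          rw [Fin.lt_def] at hci
          rw [Fin.le_def]
          simpa using hci)
        have h2 := (h j).1
        simp only [Matrix.of_apply, interlacingColumns_castSucc]
        rw [if_neg (by omega)]
  · by_contra hdet
    refine h ((interlaces_iff nu la).2 ?_)
    -- If no lower point lies between two consecutive upper points, no step function separates them
    -- and their rows coincide.
    have hex : ∀ i : Fin N, ∃ j : Fin N, coord la i.succ ≤ coord nu j ∧
        coord nu j < coord la i.castSucc := by
      intro i
      by_contra! hno
      refine hdet (Matrix.det_zero_of_row_eq (Fin.castSucc_lt_succ (i := i)).ne ?_)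
      funext c
      induction c using Fin.lastCases with
      | last => simp
      | cast j =>
        have h1 := hl (Fin.castSucc_lt_succ (i := i))
        have h2 := hno j
        simp only [Matrix.of_apply, interlacingColumns_castSucc]
        by_cases h3 : coord nu j < coord la i.succ
        · rw [if_pos h3, if_pos (by omega)]
        · rw [if_neg h3, if_neg (by have := h2 (by omega); omega)]
    choose σ hσ using hex
    -- The intervals are disjoint and ordered, and a strictly increasing self-map of `Fin N` is the
    -- identity.
    have hmono : StrictMono σ := by
      intro i k hik
      have h1 : coord la k.castSucc ≤ coord la i.succ :=
        hl.antitone (by rw [Fin.le_def]; simpa using hik)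
      have h2 := (hσ i).1
      have h3 := (hσ k).2
      rw [← hn.lt_iff_gt]
      omega
    have hid : σ = id := (hmono.range_inj strictMono_id).1 (by
      rw [(Finite.injective_iff_surjective.1 hmono.injective).range_eq, Set.range_id])
    intro j
    simpa [hid] using hσ j

/-- The determinant also vanishes on the walls in the lower variables, so `sum_coordKernel_mul`
applies to the transposed kernel. -/
theorem alternant_interlacingColumns_eq_zero (y : Fin (N + 1) → ℤ) (x : Fin N → ℤ)
    (hx : ¬ Function.Injective x) : alternant (interlacingColumns x) y = 0 := by
  simp only [Function.Injective, not_forall] at hx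
  obtain ⟨i, j, hij, hne⟩ := hx
  refine Matrix.det_zero_of_column_eq
    (fun h => hne (Fin.castSucc_injective _ h) : i.castSucc ≠ j.castSucc) fun r => ?_
  simp [hij]

/-- The one-particle intertwining relation. -/
theorem bdGen_indicator (u u' v v' : ℂ) (n x : ℤ) :
    bdGen (birth (u + 1) (u' + 1)) (death v v') (fun y => if n < y then 1 else 0) x =
      ∑ y ∈ Finset.Icc (n - 1) (n + 1), bdRate u u' v v' y n * (if y < x then 1 else 0) -
        ((u + u' + v + v').re + 2) * (if n < x then 1 else 0) := by
  have h1 : bdRate u u' v v' (n - 1) n = birth u u' (n - 1) := by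
    rw [bdRate, if_pos (by omega), birth]
  have h2 : bdRate u u' v v' n n = -birth u u' n - death v v' n := by
    rw [bdRate, if_neg (by omega), if_neg (by omega), if_pos rfl, birth, death]
  have h3 : bdRate u u' v v' (n + 1) n = death v v' (n + 1) := by
    rw [bdRate, if_neg (by omega), if_pos (by omega), death]
  have h4 : birth (u + 1) (u' + 1) x = birth u u' (x - 1) := by
    simp only [birth]
    push_cast
    ring_nf
  rw [sum_Icc_three, h1, h2, h3, bdGen, h4]
  simp only [birth_eq, death_eq, Complex.add_re]
  -- For x ≥ n + 2 the identity says that the column sums of `bdRate` have the constant value Re(u +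
  -- u' + v + v') + 2, since birth and death rates have the same quadratic term. The boundary cases
  -- are x = n and x = n + 1.
  rcases lt_trichotomy n x with h | h | h
  · rcases (Int.add_one_le_of_lt h).eq_or_lt with h' | h'
    · subst h'
      simp
      ring
    · rw [if_pos (by omega), if_pos h, if_pos (by omega), if_pos (by omega), if_pos h']
      push_cast
      ring
  · subst h
    simp
  · rw [if_neg (by omega), if_neg (by omega), if_neg (by omega), if_neg (by omega),
      if_neg (by omega)]
    ring

theorem updateCol_interlacingColumns (y : Fin (N + 1) → ℤ) (x : Fin N → ℤ) (j : Fin N) (m : ℤ) :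
    (Matrix.of fun i c => interlacingColumns x c (y i)).updateCol j.castSucc
        (fun i => if m < y i then 1 else 0) =
      Matrix.of fun i c => interlacingColumns (Function.update x j m) c (y i) := by
  ext i c
  induction c using Fin.lastCases with
  | last => simp [Matrix.updateCol_ne (Fin.castSucc_lt_last j).ne']
  | cast k =>
    by_cases hk : k = j
    · subst hk; simp
    · have : k.castSucc ≠ j.castSucc := fun h => hk (Fin.castSucc_injective _ h)
      simp [Matrix.updateCol_ne this, Function.update_of_ne hk]

/-- The generator kills the column of ones; each of the other N columns becomes the transposed
action on one lower point, minus the column-sum constant. -/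
theorem sum_det_updateCol_interlacingColumns (u u' v v' : ℂ) (y : Fin (N + 1) → ℤ)
    (x : Fin N → ℤ) :
    ∑ c, ((Matrix.of fun i c => interlacingColumns x c (y i)).updateCol c fun i =>
        bdGen (birth (u + 1) (u' + 1)) (death v v') (interlacingColumns x c) (y i)).det =
      ∑ j, ∑ m ∈ Finset.Icc (x j - 1) (x j + 1), bdRate u u' v v' m (x j) *
          alternant (interlacingColumns (Function.update x j m)) y -
        N * ((u + u' + v + v').re + 2) * alternant (interlacingColumns x) y := by
  rw [Fin.sum_univ_castSucc]
  have hlast : ((Matrix.of fun i c => interlacingColumns x c (y i)).updateCol (Fin.last N) fun i =>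
      bdGen (birth (u + 1) (u' + 1)) (death v v')
        (interlacingColumns x (Fin.last N)) (y i)).det = 0 := by
    refine Matrix.det_eq_zero_of_column_eq_zero (Fin.last N) fun i => ?_
    simp [bdGen]
  have hcast : ∀ j : Fin N, ((Matrix.of fun i c => interlacingColumns x c (y i)).updateCol
      j.castSucc fun i => bdGen (birth (u + 1) (u' + 1)) (death v v')
        (interlacingColumns x j.castSucc) (y i)).det =
      ∑ m ∈ Finset.Icc (x j - 1) (x j + 1), bdRate u u' v v' m (x j) *
          alternant (interlacingColumns (Function.update x j m)) y -
        ((u + u' + v + v').re + 2) * alternant (interlacingColumns x) y := by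
    intro j
    have h1 : (fun i => bdGen (birth (u + 1) (u' + 1)) (death v v')
        (interlacingColumns x j.castSucc) (y i)) =
        ∑ m ∈ Finset.Icc (x j - 1) (x j + 1), bdRate u u' v v' m (x j) •
          (fun i => if m < y i then (1 : ℝ) else 0) -
        ((u + u' + v + v').re + 2) • (fun i => if x j < y i then (1 : ℝ) else 0) := by
      funext i
      have : interlacingColumns x j.castSucc = fun z => if x j < z then 1 else 0 :=
        funext fun z => interlacingColumns_castSucc x j z
      rw [this, bdGen_indicator]
      simp [Finset.sum_apply]
    have h2 : ∀ m, alternant (interlacingColumns (Function.update x j m)) y =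
        Matrix.cramer (Matrix.of fun i c => interlacingColumns x c (y i))
          (fun i => if m < y i then 1 else 0) j.castSucc := by
      intro m
      rw [Matrix.cramer_apply, updateCol_interlacingColumns, alternant]
    have h3 : alternant (interlacingColumns x) y =
        alternant (interlacingColumns (Function.update x j (x j))) y := by
      rw [Function.update_eq_self]
    rw [h1, ← Matrix.cramer_apply, h3]
    simp only [h2, map_sub, map_sum, map_smul, Pi.sub_apply, Finset.sum_apply, Pi.smul_apply,
      smul_eq_mul]
  rw [hlast, add_zero, Finset.sum_congr rfl fun j _ => hcast j, Finset.sum_sub_distrib]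
  simp
  ring

/-- The finite set of signatures that interlace a given one. -/
noncomputable def interlacing (la : Signature (N + 1)) : Finset (Signature N) :=
  (Fintype.piFinset fun j : Fin N =>
    Finset.Ico (coord la j.succ) (coord la j.castSucc)).preimage coord coord_injective.injOn

theorem mem_interlacing {la : Signature (N + 1)} {nu : Signature N} :
    nu ∈ interlacing la ↔ Interlaces nu la := by
  rw [interlacing, Finset.mem_preimage, Fintype.mem_piFinset, interlaces_iff]
  simp only [Finset.mem_Ico]

theorem linkProb_eq_zero (la : Signature (N + 1)) (nu : Signature N) (h : nu ∉ interlacing la) :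
    linkProb N la nu = 0 :=
  if_neg fun h' => h (mem_interlacing.2 h')

theorem linkProb_nonneg (la : Signature (N + 1)) (nu : Signature N) : 0 ≤ linkProb N la nu := by
  rw [linkProb]
  split_ifs
  · exact mul_nonneg (Nat.cast_nonneg _) (div_nonneg (vandermonde_pos _).le (vandermonde_pos _).le)
  · exact le_rfl

theorem prod_Ioi_castSucc (i : Fin N) (h : Fin (N + 1) → ℝ) :
    ∏ j ∈ Finset.Ioi i.castSucc, h j = h i.succ * ∏ j ∈ Finset.Ioi i, h j.succ := by
  have h1 : Finset.Ioi i.castSucc = (Finset.Ici i).image Fin.succ := by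
    ext k
    induction k using Fin.cases with
    | zero => simp [Fin.succ_ne_zero]
    | succ k => simp [Fin.castSucc_lt_succ_iff]
  rw [h1, Finset.prod_image (Fin.succ_injective _).injOn, ← Finset.Ioi_insert,
    Finset.prod_insert (by simp)]

/-- A uniform bound on row sums suffices for the intertwining. Each lower difference is at most the
matching l_i - l_(j+1) with i < j; the number of interlacing signatures is at most the product of
the gaps l_j - l_(j+1); together these factors form the upper Vandermonde product. -/
theorem sum_linkProb_le (la : Signature (N + 1)) :
    ∑ nu ∈ interlacing la, linkProb N la nu ≤ N.factorial := by
  set P : ℝ := ∏ i : Fin N, ∏ j ∈ Finset.Ioi i,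
    ((coord la i.castSucc - coord la j.succ : ℤ) : ℝ) with hP
  have hl := coord_strictAnti la
  have hle : ∀ nu ∈ interlacing la, linkProb N la nu ≤ N.factorial * (P / vandermonde la) := by
    intro nu hnu
    rw [mem_interlacing] at hnu
    rw [linkProb, if_pos hnu]
    rw [interlaces_iff] at hnu
    refine mul_le_mul_of_nonneg_left ?_ (Nat.cast_nonneg _)
    refine div_le_div_of_nonneg_right ?_ (vandermonde_pos la).le
    refine Finset.prod_le_prod (fun i _ => Finset.prod_nonneg fun j hj => ?_) fun i _ =>
      Finset.prod_le_prod (fun j hj => ?_) fun j _ => ?_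
    · have := coord_strictAnti nu (Finset.mem_Ioi.1 hj)
      exact_mod_cast (sub_pos.2 this).le
    · have := coord_strictAnti nu (Finset.mem_Ioi.1 hj)
      exact_mod_cast (sub_pos.2 this).le
    · have h1 := (hnu i).2
      have h2 := (hnu j).1
      exact_mod_cast (by omega : coord nu i - coord nu j ≤ coord la i.castSucc - coord la j.succ)
  have hcard : ((interlacing la).card : ℝ) ≤
      ∏ j : Fin N, ((coord la j.castSucc - coord la j.succ : ℤ) : ℝ) := by
    have h1 : (interlacing la).card ≤ (Fintype.piFinset fun j : Fin N =>
        Finset.Ico (coord la j.succ) (coord la j.castSucc)).card :=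
      Finset.card_le_card_of_injOn coord (fun nu hnu => Finset.mem_preimage.1 hnu)
        coord_injective.injOn
    rw [Fintype.card_piFinset] at h1
    refine (Nat.cast_le.2 h1).trans (le_of_eq ?_)
    rw [Nat.cast_prod]
    refine Finset.prod_congr rfl fun j _ => ?_
    rw [Int.card_Ico]
    have := hl (Fin.castSucc_lt_succ (i := j))
    have h2 : (((coord la j.castSucc - coord la j.succ).toNat : ℕ) : ℤ) =
      coord la j.castSucc - coord la j.succ := Int.toNat_of_nonneg (by omega)
    exact_mod_cast congrArg (Int.cast : ℤ → ℝ) h2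
  have hvand : vandermonde la =
      (∏ j : Fin N, ((coord la j.castSucc - coord la j.succ : ℤ) : ℝ)) * P := by
    rw [vandermonde, Fin.prod_univ_castSucc, hP, ← Finset.prod_mul_distrib]
    have : Finset.Ioi (Fin.last N) = ∅ := by ext; simp [Fin.le_last]
    rw [this, Finset.prod_empty, mul_one]
    refine Finset.prod_congr rfl fun i _ => ?_
    exact prod_Ioi_castSucc i fun j => ((coord la i.castSucc - coord la j : ℤ) : ℝ)
  have hPpos : 0 ≤ P := Finset.prod_nonneg fun i _ => Finset.prod_nonneg fun j hj => by
    have : coord la j.succ < coord la i.castSucc := hl (by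
      have := Finset.mem_Ioi.1 hj
      rw [Fin.lt_def] at this ⊢
      simp only [Fin.val_castSucc, Fin.val_succ]
      omega)
    exact_mod_cast (sub_pos.2 this).le
  have hv := vandermonde_pos la
  calc ∑ nu ∈ interlacing la, linkProb N la nu
      ≤ (interlacing la).card • (N.factorial * (P / vandermonde la)) :=
        Finset.sum_le_card_nsmul _ _ _ hle
    _ = N.factorial * ((interlacing la).card * P / vandermonde la) := by
        rw [nsmul_eq_mul]
        ring
    _ ≤ N.factorial * 1 := by
        refine mul_le_mul_of_nonneg_left ?_ (Nat.cast_nonneg _)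
        rw [div_le_one hv, hvand]
        exact mul_le_mul_of_nonneg_right hcard hPpos
    _ = N.factorial := mul_one _

theorem dConst_succ (N : ℕ) (u u' v v' : ℂ) :
    dConst (N + 1) (u + 1) (u' + 1) v v' =
      dConst N u u' v v' - N * ((u + u' + v + v').re + 2) := by
  simp only [dConst, Complex.add_re, Complex.one_re]
  push_cast
  ring

/-- The links intertwine the matrices of transition rates. -/
theorem sum_gtRate_mul_linkProb (u u' v v' : ℂ) (la : Signature (N + 1)) (nu : Signature N) :
    ∑ ka ∈ neighbors la, gtRate (N + 1) (u + 1) (u' + 1) v v' la ka * linkProb N ka nu =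
      ∑ mu ∈ interlacing la, linkProb N la mu * gtRate N u u' v v' mu nu := by
  set Φ : (Fin N → ℤ) → ℝ := fun x => alternant (interlacingColumns x) (coord la) with hΦ
  set K : ℝ := N.factorial * vandermonde nu / vandermonde la with hK
  have hV := (vandermonde_pos la).ne'
  have hlink : ∀ (ka : Signature (N + 1)) (mu : Signature N), linkProb N ka mu =
      N.factorial * (vandermonde mu / vandermonde ka) *
        alternant (interlacingColumns (coord mu)) (coord ka) := by
    intro ka mu
    rw [alternant_interlacingColumns, linkProb]
    split_ifs <;> ring
  -- The Vandermonde factors of mu in link and rate cancel, leaving the transposed kernel acting on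
  -- the lower points.
  have hright : ∑ mu ∈ interlacing la, linkProb N la mu * gtRate N u u' v v' mu nu =
      K * (∑ j, ∑ m ∈ Finset.Icc (coord nu j - 1) (coord nu j + 1),
        bdRate u u' v v' m (coord nu j) * Φ (Function.update (coord nu) j m) -
          dConst N u u' v v' * Φ (coord nu)) := by
    have hsupp : ∀ x y : ℤ, y ∉ Finset.Icc (x - 1) (x + 1) → bdRate u u' v v' y x = 0 := by
      intro x y h
      refine bdRate_eq_zero _ _ _ _ _ _ fun h' => h ?_
      rw [Finset.mem_Icc] at h' ⊢
      omega
    have hker : ∀ mu, coordKernel (bdRate u u' v v') mu nu =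
        coordKernel (fun x y => bdRate u u' v v' y x) nu mu := by
      intro mu
      simp only [coordKernel, eq_comm]
    rw [← sum_coordKernel_mul hsupp (alternant_interlacingColumns_eq_zero (coord la)) nu]
    set U := interlacing la ∪ neighbors nu with hU
    have e1 : ∑ mu ∈ interlacing la, linkProb N la mu * gtRate N u u' v v' mu nu =
        ∑ mu ∈ U, linkProb N la mu * gtRate N u u' v v' mu nu :=
      Finset.sum_subset Finset.subset_union_left fun mu _ h => by
        rw [linkProb_eq_zero la mu h, zero_mul]
    have e2 : ∑ mu ∈ neighbors nu, coordKernel (fun x y => bdRate u u' v v' y x) nu mu *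
          Φ (coord mu) =
        ∑ mu ∈ U, coordKernel (fun x y => bdRate u u' v v' y x) nu mu * Φ (coord mu) :=
      Finset.sum_subset Finset.subset_union_right fun mu _ h => by
        rw [coordKernel_eq_zero hsupp h, zero_mul]
    have e3 : dConst N u u' v v' * Φ (coord nu) =
        ∑ mu ∈ U, if mu = nu then dConst N u u' v v' * Φ (coord mu) else 0 := by
      rw [Finset.sum_ite_eq', if_pos (Finset.mem_union_right _ (self_mem_neighbors nu))]
    rw [e1, e2, e3, ← Finset.sum_sub_distrib, Finset.mul_sum]
    refine Finset.sum_congr rfl fun mu _ => ?_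
    rw [hlink, gtRate_eq, hker]
    have hVmu := (vandermonde_pos mu).ne'
    have hVnu := (vandermonde_pos nu).ne'
    simp only [hΦ, hK]
    split_ifs with h
    · subst h
      field_simp
    · field_simp
      ring
  have hleft := sum_gtRate_mul (u + 1) (u' + 1) v v' la
    (fun ka => alternant (interlacingColumns (coord nu)) (coord ka) / vand (coord ka))
    (interlacingColumns (coord nu)) fun ka => mul_div_cancel₀ _ (vand_coord_ne_zero ka)
  rw [sum_det_updateCol_interlacingColumns, dConst_succ] at hleft
  have hvand := vand_coord_ne_zero la
  have hscale : ∀ ka : Signature (N + 1), linkProb N ka nu = K * vand (coord la) *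
      (alternant (interlacingColumns (coord nu)) (coord ka) / vand (coord ka)) := by
    intro ka
    have h1 := vandermonde_div ka la
    have hk := (vandermonde_pos ka).ne'
    have hvk := vand_coord_ne_zero ka
    rw [hlink, hK]
    rw [div_eq_div_iff hk hvk] at h1
    field_simp
    linear_combination
      vandermonde nu * alternant (interlacingColumns (coord nu)) (coord ka) * h1
  have hsum : ∑ ka ∈ neighbors la,
      gtRate (N + 1) (u + 1) (u' + 1) v v' la ka * linkProb N ka nu =
      K * vand (coord la) * ∑ ka ∈ neighbors la, gtRate (N + 1) (u + 1) (u' + 1) v v' la ka *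
        (alternant (interlacingColumns (coord nu)) (coord ka) / vand (coord ka)) := by
    rw [Finset.mul_sum]
    refine Finset.sum_congr rfl fun ka _ => ?_
    rw [hscale]
    ring
  rw [hright, hsum, hleft]
  field_simp
  ring

theorem gtRate_nonneg {u u' v v' : ℂ} (hb : ∀ x, 0 ≤ birth u u' x) (hd : ∀ x, 0 ≤ death v v' x)
    (la nu : Signature N) (h : nu ≠ la) : 0 ≤ gtRate N u u' v v' la nu := by
  rw [gtRate_eq, if_neg h.symm, sub_zero]
  refine mul_nonneg (div_nonneg (vandermonde_pos _).le (vandermonde_pos _).le)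
    (Finset.sum_nonneg fun j _ => ?_)
  split_ifs with hj
  · have hne : coord nu j ≠ coord la j := by
      intro heq
      refine h (coord_injective ?_)
      rw [← eq_update_of_forall_ne hj, heq, Function.update_eq_self]
    rw [bdRate, if_neg hne]
    split_ifs
    · exact hb _
    · exact hd _
    · exact le_rfl
  · exact le_rfl

end Link

end GelfandTsetlin

/-! ### Specialization to the parameters z, z', w, w'. -/

theorem theorem4p1 (z z' w w' : ℂ)
    (hz : ∀ k : ℤ, 0 < (z + k) * (z' + k))
    (hw : ∀ k : ℤ, 0 < (w + k) * (w' + k))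
    (hzw : -1 < z + z' + w + w') :
    (∀ N : ℕ, 1 ≤ N → GelfandTsetlin.IsRegular (GelfandTsetlin.zwRate z z' w w' N)) ∧
    ∀ N : ℕ, 1 ≤ N → ∀ t : ℝ, 0 ≤ t →
      GelfandTsetlin.comp (GelfandTsetlin.zwSemigroup z z' w w' (N + 1) t)
          (GelfandTsetlin.link N) =
        GelfandTsetlin.comp (GelfandTsetlin.link N)
          (GelfandTsetlin.zwSemigroup z z' w w' N t) := by
  open GelfandTsetlin in
  have hb : ∀ (N : ℕ) (x : ℤ), 0 ≤ birth (z + N - 1) (z' + N - 1) x := by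
    intro N x
    have h := (Complex.pos_iff.1 (hz (N - 1 - x))).1
    -- Both factors change sign, so the birth rate at x is (z + k)(z' + k) with k = N - 1 - x.
    have e : ((x : ℂ) - (z + N - 1)) * (x - (z' + N - 1)) =
        (z + (N - 1 - x : ℤ)) * (z' + (N - 1 - x : ℤ)) := by push_cast; ring
    rw [birth, e]
    exact h.le
  have hd : ∀ x : ℤ, 0 ≤ death w w' x := by
    intro x
    have h := (Complex.pos_iff.1 (hw x)).1
    rw [death, add_comm _ w, add_comm _ w']
    exact h.le
  refine ⟨fun N hN => ?_, fun N hN t ht => ?_⟩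
  · obtain ⟨n, rfl⟩ : ∃ n, N = n + 1 := ⟨N - 1, by omega⟩
    obtain ⟨C, hC⟩ := exists_sum_gtRate_mul_lyapunov_le n (z + (n + 1 : ℕ) - 1)
      (z' + (n + 1 : ℕ) - 1) w w'
    exact isRegular_of_lyapunov (gtRate_eq_zero _ _ _ _) (gtRate_nonneg (hb _) hd)
      (sum_gtRate _ _ _ _) lyapunov_pos finite_lyapunov_le hC
  · obtain ⟨C, hC⟩ := exists_sum_gtRate_mul_lyapunov_le N (z + (N + 1 : ℕ) - 1)
      (z' + (N + 1 : ℕ) - 1) w w'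
    refine comp_minimalSolution_eq (gtRate_eq_zero _ _ _ _) (gtRate_nonneg (hb _) hd)
      (sum_gtRate _ _ _ _) lyapunov_pos finite_lyapunov_le hC (gtRate_eq_zero _ _ _ _)
      (gtRate_nonneg (hb _) hd) (sum_gtRate _ _ _ _) linkProb_eq_zero linkProb_nonneg
      sum_linkProb_le (fun la nu => ?_) ht
    -- Raising N by one raises u and u' by one, exactly the shift in the one-particle relation.
    have h1 : z + (N + 1 : ℕ) - 1 = z + N - 1 + 1 := by push_cast; ring
    have h2 : z' + (N + 1 : ℕ) - 1 = z' + N - 1 + 1 := by push_cast; ring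
    rw [h1, h2]
    exact sum_gtRate_mul_linkProb _ _ _ _ la nu
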